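/- Let $\mathbb X$ be a set of treatments, $f:\mathbb X\to\mathbb R^p$ ($p\ge 1$) a regression function, and for a design $X=(x_1,\dots,x_n)\in\mathbb X^n$ let $F$ be the $n\times p$ matrix with $i$th row $f(x_i)^T$; only designs with $F^TF$ invertible are considered. Let $q$ be the number of distinct values among $x_1,\dots,x_n$, let $Z$ be the $n\times q$ indicator matrix of these unique treatments, $H_Z=Z(Z^TZ)^{-1}Z^T$, and let $d=n-q$ be the pure-error degrees of freedom. *Loss, weight, posterior.* The sum-of-squares loss is $\ell(t;y,X)=\sum_{i=1}^n (y_i-f(x_i)^Tt)^2$ and the calibration weight is $w=1/(2\tilde\sigma^2)$ with $\tilde\sigma^2=y^T(I_n-H_Z)y/(n-q)$. Under the uniform prior on $\mathbb R^p$ the Gibbs posterior has density $\pi(t\mid y,X)\propto \exp[-w\,\ell(t;y,X)]$. The utilities are $u_{NSE}(t,y,X)=-\|t-m\|_2^2$, where $m$ is the Gibbs posterior mean, and $u_{SH}(t,y,X)=\log\pi(t\mid y,X)$; both are set to $-\infty$ where the Gibbs posterior does not exist (in particular if $d=0$). *Designer distribution.* The hyper-variables $r=(\mu(\cdot),\sigma^2,\kappa)$,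 with $\mu:\mathbb X\to\mathbb R$, have a distribution $\mathcal C$ which does not depend on $X$, with $\kappa>0$ almost surely, $\kappa$ and $\sigma^2$ integrable, and $\mathrm E_{\mathcal C}(\kappa)=\mathrm E_{\mathcal C}(\sigma^2)$ (as is the case if $\mathrm E_{\mathcal C}(\kappa\mid\sigma^2)=\sigma^2$, for instance if $\sigma^2=\mathrm E_{\mathcal C}(\kappa)$ is a constant). Given $r$, the responses under $\mathcal D(r;X)$ are $y_i=\mu(x_i)+e_i$ with $e_1,\dots,e_n$ independent $N(0,\kappa)$. The target parameter value $\theta(r)$ is the minimiser over $t\in\mathbb R^p$ of $\mathrm E_{\mathcal D(r;X)}[w\,\ell(t;y,X)]$ (with finite minimum), or, alternatively, of the unweighted expected loss $\mathrm E_{\mathcal D(r;X)}[\ell(t;y,X)]$. The Gibbs expected utility is $U(X)=\mathrm E_{\mathcal C}\{\mathrm E_{\mathcal D(r;X)}[u(\theta(r),y,X)]\}$, an expectation with values in $[-\infty,\infty]$. Then the following hold for every $n$ and every such design $X$. 1. For every $r$ with $\kappa>0$, $(F^TF)^{-1}F^T(\mu(x_1),\dots,\mu(x_n))^T$ is the unique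 minimiser of the unweighted expected loss and, if $d>2$, also the unique minimiser of the weighted expected loss. 2. The Gibbs expected NSE utility exists and equals $$U_{NSE}(X)=\mathrm E_{\mathcal C}(\sigma^2)\cdot\bigl(-\mathrm{tr}[(F^TF)^{-1}]\,h_1(d)\bigr),\qquad 0<\mathrm E_{\mathcal C}(\sigma^2)<\infty,$$ where $h_1(d)=1$ for $d>0$ and $h_1(0)=\infty$. 3. If moreover $\log\kappa$ is integrable under $\mathcal C$, the Gibbs expected SH utility exists and equals $$U_{SH}(X)=-\frac p2\bigl[\log(2\pi)+\mathrm E_{\mathcal C}(\log\kappa)+\log 2\bigr]+\frac12\bigl(-p\,h_2(d)+\log|F^TF|\bigr),$$ where $h_2(d)=\psi(d/2)-\log d+\frac{d}{d-2}$ for $d>2$, with $\psi$ the digamma function, and $h_2(d)=\infty$ for $d\le 2$. In particular, neither $\mathrm E_{\mathcal C}(\sigma^2)$ nor the additive constant in part 3 depends on the design. -/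

import Mathlib

open MeasureTheory ProbabilityTheory Matrix
open scoped ENNReal NNReal

namespace GibbsDesign

noncomputable section

/-! ### Expectations with values in the extended reals -/

/-- The expectation of the extended-real random variable `g` under `P` exists and equals `a`:
`g` is a.e. measurable, its positive and negative parts do not both have infinite expectation, and
`a = E[g⁺] - E[g⁻]`. -/
def HasExpectation {Ω : Type*} [MeasurableSpace Ω] (P : Measure Ω) (g : Ω → EReal) (a : EReal) :
    Prop :=
  AEMeasurable g P ∧
    ((∫⁻ x, (g x).toENNReal ∂P) ≠ ⊤ ∨ (∫⁻ x, (-g x).toENNReal ∂P) ≠ ⊤) ∧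
    a = ((∫⁻ x, (g x).toENNReal ∂P : ℝ≥0∞) : EReal) - ((∫⁻ x, (-g x).toENNReal ∂P : ℝ≥0∞) : EReal)

/-! ### Gibbs inference with a `p`-dimensional parameter and `n` responses -/

section Gibbs

variable {n p : ℕ}

/-- `‖u‖_V = uᵀ V u`. -/
def quadForm {m : ℕ} (V : Matrix (Fin m) (Fin m) ℝ) (u : Fin m → ℝ) : ℝ := u ⬝ᵥ (V *ᵥ u)

/-- The unnormalised Gibbs posterior density `exp[-w ℓ(t)] π(t)`. -/
def gibbsKernel (w : ℝ) (loss prior : (Fin p → ℝ) → ℝ) (t : Fin p → ℝ) : ℝ :=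
  Real.exp (-(w * loss t)) * prior t

/-- The Gibbs posterior exists: the calibration weight is positive, and the unnormalised density
can be normalised. -/
def GibbsPosteriorExists (w : ℝ) (loss prior : (Fin p → ℝ) → ℝ) : Prop :=
  0 < w ∧ (∫⁻ t, ENNReal.ofReal (gibbsKernel w loss prior t)) ≠ 0 ∧
    (∫⁻ t, ENNReal.ofReal (gibbsKernel w loss prior t)) ≠ ⊤

/-- The Gibbs posterior density with respect to Lebesgue measure. -/
def gibbsPdf (w : ℝ) (loss prior : (Fin p → ℝ) → ℝ) (t : Fin p → ℝ) : ℝ :=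
  gibbsKernel w loss prior t / ∫ s, gibbsKernel w loss prior s

/-- The Gibbs posterior distribution. -/
def gibbsPosterior (w : ℝ) (loss prior : (Fin p → ℝ) → ℝ) : Measure (Fin p → ℝ) :=
  volume.withDensity fun t => ENNReal.ofReal (gibbsPdf w loss prior t)

/-- The Gibbs posterior mean. -/
def gibbsMean (w : ℝ) (loss prior : (Fin p → ℝ) → ℝ) : Fin p → ℝ :=
  ∫ t, t ∂(gibbsPosterior w loss prior)

open Classical in
/-- Negative squared error utility; it is `-∞` if there is no Gibbs posterior. -/
def utilityNSE (w : ℝ) (loss prior : (Fin p → ℝ) → ℝ) (t : Fin p → ℝ) : EReal :=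
  if GibbsPosteriorExists w loss prior then
    ((-quadForm 1 (t - gibbsMean w loss prior) : ℝ) : EReal)
  else ⊥

open Classical in
/-- Shannon information utility; it is `-∞` if there is no Gibbs posterior. -/
def utilitySH (w : ℝ) (loss prior : (Fin p → ℝ) → ℝ) (t : Fin p → ℝ) : EReal :=
  if GibbsPosteriorExists w loss prior then
    ((Real.log (gibbsPdf w loss prior t) : ℝ) : EReal)
  else ⊥

/-- `t` minimises the expected weighted loss `E_D[w(y) ℓ(t; y)]` (of a nonnegative loss), and the
minimum is finite. -/
def IsTarget (D : Measure (Fin n → ℝ)) (w : (Fin n → ℝ) → ℝ)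
    (loss : (Fin p → ℝ) → (Fin n → ℝ) → ℝ) (t : Fin p → ℝ) : Prop :=
  (∫⁻ y, ENNReal.ofReal (w y * loss t y) ∂D) ≠ ⊤ ∧
    ∀ s, (∫⁻ y, ENNReal.ofReal (w y * loss t y) ∂D) ≤ ∫⁻ y, ENNReal.ofReal (w y * loss s y) ∂D

/-- `U` is the expected utility `E_C { E_{D(r)} [u(θ(r), y)] }`, with both expectations existing in
the extended reals. -/
def IsExpectedUtility {R : Type*} [MeasurableSpace R] (C : Measure R)
    (D : R → Measure (Fin n → ℝ)) (u : (Fin p → ℝ) → (Fin n → ℝ) → EReal)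
    (θ : R → Fin p → ℝ) (U : EReal) : Prop :=
  ∃ inner : R → EReal,
    (∀ᵐ r ∂C, HasExpectation (D r) (fun y => u (θ r) y) (inner r)) ∧ HasExpectation C inner U

end Gibbs

/-! ### Linear models: regression function `f : 𝕏 → ℝᵖ` and design `X = (x₁, …, xₙ) ∈ 𝕏ⁿ` -/

section LinearModel

variable {𝕏 : Type*} {n p : ℕ}

/-- The model matrix, whose `i`th row is `f(xᵢ)ᵀ`. -/
def modelMatrix (f : 𝕏 → Fin p → ℝ) (X : Fin n → 𝕏) : Matrix (Fin n) (Fin p) ℝ :=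
  Matrix.of fun i => f (X i)

/-- The number `q` of unique treatments of the design. -/
def numTreatments (X : Fin n → 𝕏) : ℕ := (Set.range X).ncard

/-- The pure error degrees of freedom `d = n - q` (always `q ≤ n`). -/
def pureErrorDF (X : Fin n → 𝕏) : ℕ := n - numTreatments X

open Classical in
/-- The model matrix of the unique-treatment model; its columns are indexed by the unique
treatments. -/
def treatmentMatrix (X : Fin n → 𝕏) : Matrix (Fin n) (Set.range X) ℝ :=
  Matrix.of fun i j => if X i = j then 1 else 0

open Classical in
/-- `H_Z = Z (Zᵀ Z)⁻¹ Zᵀ`. -/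
def treatmentHat (X : Fin n → 𝕏) : Matrix (Fin n) (Fin n) ℝ :=
  treatmentMatrix X * ((treatmentMatrix X)ᵀ * treatmentMatrix X)⁻¹ * (treatmentMatrix X)ᵀ

/-- The pure error estimate of the error variance, `yᵀ (I - H_Z) y / (n - q)`. -/
def pureErrorVar (X : Fin n → 𝕏) (y : Fin n → ℝ) : ℝ :=
  1 / (pureErrorDF X : ℝ) * quadForm (1 - treatmentHat X) y

/-- The calibration weight `w = 1 / (2 σ̃²)`. If `d = 0`, where `σ̃²` is not defined, this is `0`,
which is not an admissible weight in `GibbsPosteriorExists`. -/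
def calibWeight (X : Fin n → 𝕏) (y : Fin n → ℝ) : ℝ := 1 / (2 * pureErrorVar X y)

/-- The sum of squares loss. -/
def ssLoss (f : 𝕏 → Fin p → ℝ) (X : Fin n → 𝕏) (t : Fin p → ℝ) (y : Fin n → ℝ) : ℝ :=
  ∑ i, (y i - f (X i) ⬝ᵥ t) ^ 2

/-- The hyper-variables `r = (μ(·), σ², κ)`. -/
abbrev HyperVar (𝕏 : Type*) : Type _ := (𝕏 → ℝ) × ℝ≥0 × ℝ≥0

/-- The mean response function `μ(·)`. -/
abbrev HyperVar.mean (r : HyperVar 𝕏) : 𝕏 → ℝ := r.1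

/-- The variance `σ²`. -/
abbrev HyperVar.sigmaSq (r : HyperVar 𝕏) : ℝ≥0 := r.2.1

/-- The mixing variance `κ`. -/
abbrev HyperVar.kappa (r : HyperVar 𝕏) : ℝ≥0 := r.2.2

/-- The unique-treatment designer distribution: given `r`, the responses are
`yᵢ = μ(xᵢ) + eᵢ` with `e₁, …, eₙ` independent `N(0, κ)`. -/
def designerDist (X : Fin n → 𝕏) (r : HyperVar 𝕏) : Measure (Fin n → ℝ) :=
  Measure.pi fun i => gaussianReal (HyperVar.mean r (X i)) (HyperVar.kappa r)

/-- `U` is the Gibbs expected NSE utility of the design `X` under the sum of squares loss, the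
calibration weight `1 / (2 σ̃²)` and the uniform prior, evaluated at target values `θ`. -/
def IsGibbsExpectedNSE (f : 𝕏 → Fin p → ℝ) (C : Measure (HyperVar 𝕏)) (X : Fin n → 𝕏)
    (θ : HyperVar 𝕏 → Fin p → ℝ) (U : EReal) : Prop :=
  IsExpectedUtility C (designerDist X)
    (fun t y => utilityNSE (calibWeight X y) (fun s => ssLoss f X s y) (fun _ => 1) t) θ U

/-- The same for the Shannon information utility. -/
def IsGibbsExpectedSH (f : 𝕏 → Fin p → ℝ) (C : Measure (HyperVar 𝕏)) (X : Fin n → 𝕏)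
    (θ : HyperVar 𝕏 → Fin p → ℝ) (U : EReal) : Prop :=
  IsExpectedUtility C (designerDist X)
    (fun t y => utilitySH (calibWeight X y) (fun s => ssLoss f X s y) (fun _ => 1) t) θ U

/-- `h₁(d) = 1` if `d > 0`, and `h₁(0) = ∞`. -/
def h₁ (d : ℕ) : EReal := if d = 0 then ⊤ else 1

/-- `h₂(d) = ψ(d/2) - log d + d/(d-2)` with `ψ` the digamma function if `d > 2`, and `∞` if
`d ≤ 2`. -/
def h₂ (d : ℕ) : EReal :=
  if d ≤ 2 then ⊤
  else (((Complex.digamma ((d : ℂ) / 2)).re - Real.log d + (d : ℝ) / ((d : ℝ) - 2) : ℝ) : EReal)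

/-- `-tr[(FᵀF)⁻¹] h₁(d)`. -/
def objectiveNSE (f : 𝕏 → Fin p → ℝ) (X : Fin n → 𝕏) : EReal :=
  -((((modelMatrix f X)ᵀ * modelMatrix f X)⁻¹.trace : ℝ) : EReal) * h₁ (pureErrorDF X)

/-- `-p h₂(d) + log |FᵀF|`. -/
def objectiveSH (f : 𝕏 → Fin p → ℝ) (X : Fin n → 𝕏) : EReal :=
  -((p : ℝ) : EReal) * h₂ (pureErrorDF X) +
    ((Real.log ((modelMatrix f X)ᵀ * modelMatrix f X).det : ℝ) : EReal)

end LinearModel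

end

end GibbsDesign

/-!
Let `e` be the least squares estimate, a linear function of the responses `y`. The loss is
`ℓ(t) = ℓ(e) + ‖t - e‖²_{FᵀF}`, so for `w > 0` the Gibbs posterior is the Gaussian distribution
`N(e, (2 w FᵀF)⁻¹)`; both utilities become explicit in terms of `w` and `t - e`.

Under `y ∼ N(μ(X), κ I)` the pure error `yᵀ (I - H_Z) y` is `κ` times a chi-squared variable with
`d` degrees of freedom, since `I - H_Z` is an orthogonal projection of rank `d` that annihilates
`μ(X)`, and it is independent of `H_F y`, since `(I - H_Z) H_F = 0`. Hence the target value is the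
least squares fit to `μ(X)`, and `E w = d / (2 κ (d - 2))`, which is finite iff `d > 2`. At the
target value, `E ‖t - e‖² = κ tr (FᵀF)⁻¹` and `E (w ‖t - e‖²_{FᵀF}) = p κ E w`, and the digamma
function is the mean of the logarithm of a gamma variable. The outer expectation is then over an
affine function of `κ` or of `log κ`.
-/

namespace GibbsDesign

noncomputable section

section Gamma

variable {a r : ℝ}

lemma gammaMeasure_eq_withDensity_restrict (a r : ℝ) :
    gammaMeasure a r = (volume.restrict (Set.Ioi 0)).withDensity fun x =>
      ENNReal.ofReal (r ^ a / Real.Gamma a * x ^ (a - 1) * Real.exp (-(r * x))) := by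
  rw [gammaMeasure, ← withDensity_indicator measurableSet_Ioi]
  refine withDensity_congr_ae ?_
  filter_upwards [Measure.ae_ne volume (0 : ℝ)] with x hx
  rcases hx.lt_or_gt with h | h
  · rw [gammaPDF_of_neg h, Set.indicator_of_notMem (by simpa using h.le)]
  · rw [gammaPDF_of_nonneg h.le, Set.indicator_of_mem (by simpa using h)]

lemma ae_pos_gammaMeasure (a r : ℝ) : ∀ᵐ x ∂gammaMeasure a r, 0 < x := by
  rw [gammaMeasure_eq_withDensity_restrict]
  exact (withDensity_absolutelyContinuous _ _).ae_le (ae_restrict_mem measurableSet_Ioi)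

lemma gammaDensity_nonneg (ha : 0 < a) (hr : 0 < r) {x : ℝ} (hx : 0 < x) :
    0 ≤ r ^ a / Real.Gamma a * x ^ (a - 1) * Real.exp (-(r * x)) := by
  have := Real.Gamma_pos_of_pos ha
  positivity

variable {F : Type*} [NormedAddCommGroup F] [NormedSpace ℝ F]

lemma integral_gammaMeasure (ha : 0 < a) (hr : 0 < r) (f : ℝ → F) :
    ∫ x, f x ∂gammaMeasure a r = ∫ x in Set.Ioi 0,
      (r ^ a / Real.Gamma a * x ^ (a - 1) * Real.exp (-(r * x))) • f x := by
  rw [gammaMeasure_eq_withDensity_restrict,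
    integral_withDensity_eq_integral_toReal_smul (by fun_prop) (by simp)]
  refine setIntegral_congr_fun measurableSet_Ioi fun x hx => ?_
  simp only [ENNReal.toReal_ofReal (gammaDensity_nonneg ha hr hx)]

lemma integrable_gammaMeasure_iff (ha : 0 < a) (hr : 0 < r) {f : ℝ → F} :
    Integrable f (gammaMeasure a r) ↔ IntegrableOn (fun x =>
      (r ^ a / Real.Gamma a * x ^ (a - 1) * Real.exp (-(r * x))) • f x) (Set.Ioi 0) := by
  rw [gammaMeasure_eq_withDensity_restrict,
    integrable_withDensity_iff_integrable_smul' (by fun_prop) (by simp)]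
  refine integrable_congr ?_
  filter_upwards [ae_restrict_mem measurableSet_Ioi] with x hx
  rw [ENNReal.toReal_ofReal (gammaDensity_nonneg ha hr hx)]

lemma integral_gammaMeasure_eq_integral_comp_sq (ha : 0 < a) (hr : 0 < r) (f : ℝ → F) :
    ∫ x, f x ∂gammaMeasure a r = (2 * (r ^ a / Real.Gamma a)) •
      ∫ ρ in Set.Ioi (0 : ℝ), (ρ ^ (2 * a - 1) * Real.exp (-(r * ρ ^ 2))) • f (ρ ^ 2) := by
  rw [integral_gammaMeasure ha hr, ← integral_comp_rpow_Ioi_of_pos two_pos, ← integral_smul]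
  refine setIntegral_congr_fun measurableSet_Ioi fun ρ hρ => ?_
  have hρ : 0 < ρ := hρ
  have hpow : ρ * (ρ ^ 2) ^ (a - 1) = ρ ^ (2 * a - 1) := by
    rw [← Real.rpow_two, ← Real.rpow_mul hρ.le, mul_comm, ← Real.rpow_add_one hρ.ne']
    ring_nf
  simp only [smul_smul, Real.rpow_two, ← hpow]
  norm_num
  ring_nf

/- The density of `gammaMeasure a r` times `x ^ s` is a multiple of the unnormalised density of
`gammaMeasure (a + s) r`. -/
lemma eqOn_gammaDensity_smul_rpow (a r s : ℝ) :
    Set.EqOn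
      (fun x => (r ^ a / Real.Gamma a * x ^ (a - 1) * Real.exp (-(r * x))) • x ^ s)
      (fun x => r ^ a / Real.Gamma a * (x ^ (a + s - 1) * Real.exp (-(r * x)))) (Set.Ioi 0) := by
  intro x hx
  simp only [add_sub_right_comm, Real.rpow_add (Set.mem_Ioi.1 hx), smul_eq_mul]
  ring

lemma integrableOn_rpow_mul_exp_neg_mul_iff {s : ℝ} (hr : 0 < r) :
    IntegrableOn (fun x : ℝ => x ^ s * Real.exp (-(r * x))) (Set.Ioi 0) ↔ -1 < s := by
  constructor
  · intro h
    rw [← intervalIntegral.integrableOn_Ioo_rpow_iff zero_lt_one]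
    refine Integrable.mono' ((h.mono_set Set.Ioo_subset_Ioi_self).const_mul (Real.exp r))
      (by fun_prop) ?_
    filter_upwards [ae_restrict_mem measurableSet_Ioo] with x hx
    have hx0 : 0 < x := hx.1
    have hexp : 1 ≤ Real.exp r * Real.exp (-(r * x)) := by
      rw [← Real.exp_add, Real.one_le_exp_iff]
      nlinarith [hx.2]
    rw [Real.norm_of_nonneg (by positivity)]
    calc x ^ s ≤ x ^ s * (Real.exp r * Real.exp (-(r * x))) :=
          le_mul_of_one_le_right (by positivity) hexp
      _ = Real.exp r * (x ^ s * Real.exp (-(r * x))) := by ring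
  · intro h
    simpa using integrableOn_rpow_mul_exp_neg_mul_rpow h one_pos hr

lemma integrable_rpow_gammaMeasure_iff (ha : 0 < a) (hr : 0 < r) {s : ℝ} :
    Integrable (fun x => x ^ s) (gammaMeasure a r) ↔ 0 < a + s := by
  have := Real.Gamma_pos_of_pos ha
  rw [integrable_gammaMeasure_iff ha hr,
    integrableOn_congr_fun (eqOn_gammaDensity_smul_rpow a r s) measurableSet_Ioi, IntegrableOn,
    integrable_const_mul_iff (IsUnit.mk0 _ (by positivity)), ← IntegrableOn,
    integrableOn_rpow_mul_exp_neg_mul_iff hr]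
  constructor <;> intro h <;> linarith

lemma integral_rpow_gammaMeasure (ha : 0 < a) (hr : 0 < r) {s : ℝ} (hs : 0 < a + s) :
    ∫ x, x ^ s ∂gammaMeasure a r = Real.Gamma (a + s) / (Real.Gamma a * r ^ s) := by
  rw [integral_gammaMeasure ha hr, setIntegral_congr_fun measurableSet_Ioi
    (eqOn_gammaDensity_smul_rpow a r s), integral_const_mul,
    Real.integral_rpow_mul_exp_neg_mul_Ioi hs hr, one_div, Real.inv_rpow hr.le, Real.rpow_add hr]
  have := Real.Gamma_pos_of_pos ha
  have : 0 < r ^ a := by positivity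
  have : 0 < r ^ s := by positivity
  field_simp

lemma integrable_inv_gammaMeasure_iff (ha : 0 < a) (hr : 0 < r) :
    Integrable (fun x => x⁻¹) (gammaMeasure a r) ↔ 1 < a := by
  simp only [← Real.rpow_neg_one, integrable_rpow_gammaMeasure_iff ha hr]
  constructor <;> intro h <;> linarith

lemma integral_inv_gammaMeasure (ha : 1 < a) (hr : 0 < r) :
    ∫ x, x⁻¹ ∂gammaMeasure a r = r / (a - 1) := by
  have ha' : 0 < a - 1 := by linarith
  have := Real.Gamma_pos_of_pos ha'
  have hrec := Real.Gamma_add_one ha'.ne'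
  simp only [← Real.rpow_neg_one]
  rw [integral_rpow_gammaMeasure (by linarith) hr (by linarith), Real.rpow_neg_one,
    ← sub_eq_add_neg, ← sub_add_cancel a 1, hrec, sub_add_cancel]
  field_simp

lemma hasDerivAt_Gamma (ha : 0 < a) :
    HasDerivAt Real.Gamma (Real.Gamma a * (Complex.digamma a).re) a := by
  have hC : HasDerivAt Complex.Gamma (deriv Complex.Gamma a) a := by
    refine (Complex.differentiableAt_Gamma _ fun m hm => ?_).hasDerivAt
    have hm' : a = -m := by simpa using congrArg Complex.re hm
    have : (0 : ℝ) ≤ m := m.cast_nonneg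
    linarith
  refine hC.real_of_complex.congr_deriv ?_
  rw [Complex.digamma_def, logDeriv_apply, Complex.Gamma_ofReal, Complex.div_ofReal_re,
    mul_div_cancel₀ _ (Real.Gamma_pos_of_pos ha).ne']

lemma exp_mul_log_ae_eq_rpow_gammaMeasure (a r s : ℝ) :
    (fun x => Real.exp (s * Real.log x)) =ᵐ[gammaMeasure a r] fun x => x ^ s := by
  filter_upwards [ae_pos_gammaMeasure a r] with x hx
  rw [Real.rpow_def_of_pos hx, mul_comm]

lemma zero_mem_interior_integrableExpSet_log_gammaMeasure (ha : 0 < a) (hr : 0 < r) :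
    0 ∈ interior (integrableExpSet Real.log (gammaMeasure a r)) := by
  have hsub : Set.Ioi (-a) ⊆ integrableExpSet Real.log (gammaMeasure a r) := fun s hs =>
    ((integrable_rpow_gammaMeasure_iff ha hr).2 (by linarith [Set.mem_Ioi.1 hs])).congr
      (exp_mul_log_ae_eq_rpow_gammaMeasure a r s).symm
  exact interior_mono hsub (by rw [interior_Ioi]; simpa using ha)

lemma integrable_log_gammaMeasure (ha : 0 < a) (hr : 0 < r) :
    Integrable Real.log (gammaMeasure a r) :=
  integrable_of_mem_interior_integrableExpSet
    (zero_mem_interior_integrableExpSet_log_gammaMeasure ha hr)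

/- The moment generating function of `log` is `s ↦ Γ(a + s) / (Γ(a) r ^ s)`; the mean of `log` is
its derivative at `0`. -/
lemma integral_log_gammaMeasure (ha : 0 < a) (hr : 0 < r) :
    ∫ x, Real.log x ∂gammaMeasure a r = (Complex.digamma a).re - Real.log r := by
  have hmgf : mgf Real.log (gammaMeasure a r) =ᶠ[nhds 0]
      fun s => Real.Gamma (a + s) / (Real.Gamma a * r ^ s) := by
    filter_upwards [Ioi_mem_nhds (neg_lt_zero.2 ha)] with s hs
    rw [mgf, integral_congr_ae (exp_mul_log_ae_eq_rpow_gammaMeasure a r s),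
      integral_rpow_gammaMeasure ha hr (by linarith [Set.mem_Ioi.1 hs])]
  have hG : Real.Gamma a ≠ 0 := (Real.Gamma_pos_of_pos ha).ne'
  have hnum : HasDerivAt (fun s => Real.Gamma (a + s))
      (Real.Gamma a * (Complex.digamma a).re) 0 :=
    HasDerivAt.comp_const_add a 0 (by simpa using hasDerivAt_Gamma ha)
  have hden : HasDerivAt (fun s : ℝ => Real.Gamma a * r ^ s) (Real.Gamma a * Real.log r) 0 := by
    simpa using ((Real.hasStrictDerivAt_const_rpow hr 0).hasDerivAt.const_mul (Real.Gamma a))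
  have hderiv := hnum.fun_div hden (by simpa using hG)
  rw [← deriv_mgf_zero (zero_mem_interior_integrableExpSet_log_gammaMeasure ha hr),
    hmgf.deriv_eq, hderiv.deriv]
  simp only [add_zero, Real.rpow_zero, mul_one]
  field_simp

lemma gammaMeasure_map_const_mul (ha : 0 < a) (hr : 0 < r) {c : ℝ} (hc : 0 < c) :
    (gammaMeasure a r).map (c * ·) = gammaMeasure a (r / c) := by
  have := isProbabilityMeasure_gammaMeasure ha hr
  have := isProbabilityMeasure_gammaMeasure ha (div_pos hr hc)
  have : IsProbabilityMeasure ((gammaMeasure a r).map (c * ·)) :=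
    Measure.isProbabilityMeasure_map (by fun_prop)
  refine Measure.ext_of_charFun (funext fun t => ?_)
  have hsubst := integral_comp_mul_left_Ioi (fun x : ℝ => ((r / c) ^ a / Real.Gamma a *
    x ^ (a - 1) * Real.exp (-(r / c * x))) • Complex.exp (t * x * Complex.I)) 0 hc
  rw [mul_zero, eq_inv_smul_iff₀ hc.ne', ← integral_smul] at hsubst
  rw [charFun_apply_real, charFun_apply_real, integral_map (by fun_prop) (by fun_prop),
    integral_gammaMeasure ha hr, integral_gammaMeasure ha (div_pos hr hc), ← hsubst]
  refine setIntegral_congr_fun measurableSet_Ioi fun x hx => ?_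
  have hx : 0 < x := hx
  have hca : c * c ^ (a - 1) = c ^ a := by
    rw [mul_comm, ← Real.rpow_add_one hc.ne', sub_add_cancel]
  have : 0 < c ^ a := by positivity
  simp only [smul_smul]
  congr 1
  rw [Real.mul_rpow hc.le hx.le, Real.div_rpow hr.le hc.le, ← hca]
  field_simp

end Gamma

section StdGaussian

open Module

variable {E : Type*} [NormedAddCommGroup E] [InnerProductSpace ℝ E] [FiniteDimensional ℝ E]
  [MeasurableSpace E] [BorelSpace E]

lemma integrable_exp_neg_half_mul_norm_sq :
    Integrable fun x : E => Real.exp (-(1 / 2) * ‖x‖ ^ 2) := by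
  refine (GaussianFourier.integrable_cexp_neg_mul_sq_norm_add (V := E) (b := 1 / 2)
    (by norm_num) 0 0).re.congr (.of_forall fun x => ?_)
  have hcast : -(1 / 2 : ℂ) * ‖x‖ ^ 2 = ((-(1 / 2) * ‖x‖ ^ 2 : ℝ) : ℂ) := by push_cast; rfl
  simp only [zero_mul, add_zero, hcast, ← Complex.ofReal_exp, RCLike.re_eq_complex_re,
    Complex.ofReal_re]

lemma stdGaussian_eq_withDensity :
    stdGaussian E = volume.withDensity fun x : E =>
      ENNReal.ofReal ((2 * Real.pi) ^ (-(finrank ℝ E / 2 : ℝ)) *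
        Real.exp (-(1 / 2) * ‖x‖ ^ 2)) := by
  have := isFiniteMeasure_withDensity_ofReal
    (integrable_exp_neg_half_mul_norm_sq (E := E).const_mul
      ((2 * Real.pi) ^ (-(finrank ℝ E / 2 : ℝ)))).2
  refine Measure.ext_of_charFun (funext fun t => ?_)
  have hconst : (((2 * Real.pi) ^ (-(finrank ℝ E / 2 : ℝ)) : ℝ) : ℂ) *
      (Real.pi / (1 / 2) : ℂ) ^ (finrank ℝ E / 2 : ℂ) = 1 := by
    rw [show (Real.pi / (1 / 2) : ℂ) = ((2 * Real.pi : ℝ) : ℂ) by push_cast; ring,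
      show (finrank ℝ E / 2 : ℂ) = ((finrank ℝ E / 2 : ℝ) : ℂ) by push_cast; rfl,
      ← Complex.ofReal_cpow (by positivity), ← Complex.ofReal_mul, ← Real.rpow_add (by positivity)]
    simp
  rw [charFun_stdGaussian, charFun_apply,
    integral_withDensity_eq_integral_toReal_smul (by fun_prop) (by simp)]
  calc Complex.exp (-‖t‖ ^ 2 / 2)
      = (((2 * Real.pi) ^ (-(finrank ℝ E / 2 : ℝ)) : ℝ) : ℂ) *
        ∫ v : E, Complex.exp (-(1 / 2) * ‖v‖ ^ 2 + Complex.I * inner ℝ t v) := by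
        rw [GaussianFourier.integral_cexp_neg_mul_sq_norm_add (by norm_num), ← mul_assoc, hconst,
          one_mul, Complex.I_sq]
        ring_nf
    _ = _ := by
        rw [← integral_const_mul]
        refine integral_congr_ae (.of_forall fun x => ?_)
        simp only [ENNReal.toReal_ofReal (by positivity : 0 ≤ (2 * Real.pi) ^
          (-(finrank ℝ E / 2 : ℝ)) * Real.exp (-(1 / 2) * ‖x‖ ^ 2)), Complex.real_smul,
          Complex.exp_add, real_inner_comm]
        push_cast
        rw [mul_assoc, mul_comm Complex.I]

lemma integral_fun_norm_stdGaussian [Nontrivial E] {F : Type*} [NormedAddCommGroup F]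
    [NormedSpace ℝ F] (f : ℝ → F) :
    ∫ x : E, f ‖x‖ ∂stdGaussian E = ((2 * Real.pi) ^ (-(finrank ℝ E / 2 : ℝ)) *
      (finrank ℝ E * volume.real (Metric.ball (0 : E) 1))) •
      ∫ ρ in Set.Ioi (0 : ℝ), ρ ^ (finrank ℝ E - 1) • Real.exp (-(1 / 2) * ρ ^ 2) • f ρ := by
  rw [stdGaussian_eq_withDensity,
    integral_withDensity_eq_integral_toReal_smul (by fun_prop) (by simp)]
  have hdensity (x : E) : (ENNReal.ofReal ((2 * Real.pi) ^ (-(finrank ℝ E / 2 : ℝ)) *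
      Real.exp (-(1 / 2) * ‖x‖ ^ 2))).toReal = (2 * Real.pi) ^ (-(finrank ℝ E / 2 : ℝ)) *
      Real.exp (-(1 / 2) * ‖x‖ ^ 2) := ENNReal.toReal_ofReal (by positivity)
  simp only [hdensity, mul_smul]
  rw [integral_smul,
    integral_fun_norm_addHaar volume fun ρ => Real.exp (-(1 / 2) * ρ ^ 2) • f ρ,
    Nat.cast_smul_eq_nsmul]

/- Polar coordinates and the substitution `x = ρ ^ 2` turn the two sides into multiples of the same
integral; that both measures are probability measures then identifies the constants. -/
lemma exists_integral_norm_sq_stdGaussian_eq_smul (hE : 0 < finrank ℝ E) :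
    ∃ c : ℝ, ∀ f : ℝ → ℂ, ∫ x : E, f (‖x‖ ^ 2) ∂stdGaussian E =
      c • ∫ x, f x ∂gammaMeasure (finrank ℝ E / 2) (1 / 2) := by
  have := nontrivial_of_finrank_pos hE
  have hdim : (0 : ℝ) < finrank ℝ E / 2 := by positivity
  set C : ℝ := 2 * ((1 / 2) ^ (finrank ℝ E / 2 : ℝ) / Real.Gamma (finrank ℝ E / 2))
  have hC : C ≠ 0 := by
    have := Real.Gamma_pos_of_pos hdim
    positivity
  refine ⟨(2 * Real.pi) ^ (-(finrank ℝ E / 2 : ℝ)) *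
    (finrank ℝ E * volume.real (Metric.ball (0 : E) 1)) * C⁻¹, fun f => ?_⟩
  rw [integral_fun_norm_stdGaussian fun ρ => f (ρ ^ 2),
    integral_gammaMeasure_eq_integral_comp_sq hdim one_half_pos, smul_smul,
    inv_mul_cancel_right₀ hC]
  congr 1
  refine setIntegral_congr_fun measurableSet_Ioi fun ρ _ => ?_
  have hpow : ρ ^ (2 * (finrank ℝ E / 2 : ℝ) - 1) = ρ ^ (finrank ℝ E - 1) := by
    rw [← Real.rpow_natCast, Nat.cast_pred hE, mul_div_cancel₀ _ two_ne_zero]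
  simp only [hpow, smul_smul, neg_mul]

lemma hasLaw_norm_sq_stdGaussian (hE : 0 < finrank ℝ E) :
    HasLaw (fun x : E => ‖x‖ ^ 2) (gammaMeasure (finrank ℝ E / 2) (1 / 2)) (stdGaussian E) := by
  have := isProbabilityMeasure_gammaMeasure (by positivity : (0 : ℝ) < finrank ℝ E / 2)
    (one_half_pos (α := ℝ))
  obtain ⟨c, hc⟩ := exists_integral_norm_sq_stdGaussian_eq_smul hE
  have hc1 : c = 1 := by
    have h := hc fun _ => 1
    simp only [integral_const, probReal_univ, one_smul] at h
    simpa using h.symm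
  refine ⟨by fun_prop, Measure.ext_of_charFun (funext fun t => ?_)⟩
  rw [charFun_apply_real, charFun_apply_real, integral_map (by fun_prop) (by fun_prop),
    hc fun x => Complex.exp (t * x * Complex.I), hc1, one_smul]

end StdGaussian

section QuadForm

variable {m : ℕ}

@[fun_prop]
lemma continuous_quadForm (V : Matrix (Fin m) (Fin m) ℝ) : Continuous (quadForm V) := by
  unfold quadForm
  fun_prop

lemma quadForm_eq_sum (V : Matrix (Fin m) (Fin m) ℝ) (u : Fin m → ℝ) :
    quadForm V u = ∑ i, ∑ j, V i j * (u i * u j) := by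
  simp only [quadForm, dotProduct, mulVec, Finset.mul_sum]
  exact Finset.sum_congr rfl fun i _ => Finset.sum_congr rfl fun j _ => by ring

lemma quadForm_neg (V : Matrix (Fin m) (Fin m) ℝ) (u : Fin m → ℝ) :
    quadForm V (-u) = quadForm V u := by
  simp only [quadForm, mulVec_neg, neg_dotProduct_neg]

lemma quadForm_sub_comm (V : Matrix (Fin m) (Fin m) ℝ) (u w : Fin m → ℝ) :
    quadForm V (u - w) = quadForm V (w - u) := by
  rw [← neg_sub, quadForm_neg]

lemma quadForm_transpose_mul_self {ι : Type*} [Fintype ι] (B : Matrix ι (Fin m) ℝ)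
    (u : Fin m → ℝ) : quadForm (Bᵀ * B) u = (B *ᵥ u) ⬝ᵥ (B *ᵥ u) := by
  rw [quadForm, ← mulVec_mulVec, dotProduct_mulVec, vecMul_transpose]

lemma quadForm_nonneg {V : Matrix (Fin m) (Fin m) ℝ} (hV : V.PosSemidef) (u : Fin m → ℝ) :
    0 ≤ quadForm V u := by
  simpa [quadForm] using hV.dotProduct_mulVec_nonneg u

lemma quadForm_pos {V : Matrix (Fin m) (Fin m) ℝ} (hV : V.PosDef) {u : Fin m → ℝ} (hu : u ≠ 0) :
    0 < quadForm V u := by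
  simpa [quadForm] using hV.dotProduct_mulVec_pos hu

variable {P : Matrix (Fin m) (Fin m) ℝ}

lemma transpose_eq_of_isStarProjection (hP : IsStarProjection P) : Pᵀ = P := by
  rw [← conjTranspose_eq_transpose_of_trivial, ← star_eq_conjTranspose, hP.isSelfAdjoint.star_eq]

lemma quadForm_eq_mulVec_dotProduct_mulVec (hP : IsStarProjection P) (u : Fin m → ℝ) :
    quadForm P u = (P *ᵥ u) ⬝ᵥ (P *ᵥ u) := by
  rw [← quadForm_transpose_mul_self, transpose_eq_of_isStarProjection hP, hP.isIdempotentElem.eq]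

lemma posSemidef_of_isStarProjection (hP : IsStarProjection P) : P.PosSemidef := by
  have h := posSemidef_conjTranspose_mul_self P
  rwa [← star_eq_conjTranspose, hP.isSelfAdjoint.star_eq, hP.isIdempotentElem.eq] at h

lemma quadForm_add_of_mulVec_eq_zero (hP : IsStarProjection P) {c : Fin m → ℝ}
    (hc : P *ᵥ c = 0) (u : Fin m → ℝ) : quadForm P (c + u) = quadForm P u := by
  rw [quadForm_eq_mulVec_dotProduct_mulVec hP, mulVec_add, hc, zero_add,
    ← quadForm_eq_mulVec_dotProduct_mulVec hP]

lemma quadForm_smul (V : Matrix (Fin m) (Fin m) ℝ) (a : ℝ) (u : Fin m → ℝ) :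
    quadForm V (a • u) = a ^ 2 * quadForm V u := by
  simp only [quadForm, mulVec_smul, dotProduct_smul, smul_dotProduct, smul_eq_mul]
  ring

end QuadForm

section PiGaussian

variable {ι : Type*} [Fintype ι]

/-- The joint distribution of independent Gaussian variables with means `m i` and common
variance `v`. -/
abbrev piGaussian (m : ι → ℝ) (v : ℝ≥0) : Measure (ι → ℝ) :=
  Measure.pi fun i => gaussianReal (m i) v

lemma map_piGaussian_zero_one (m : ι → ℝ) (v : ℝ≥0) :
    (piGaussian (0 : ι → ℝ) 1).map (fun z => m + √(v : ℝ) • z) = piGaussian m v := by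
  have hscale (i : ι) : (gaussianReal 0 1).map (fun x => m i + √(v : ℝ) * x) =
      gaussianReal (m i) v := by
    rw [show (fun x => m i + √(v : ℝ) * x) = (m i + ·) ∘ (√(v : ℝ) * ·) from rfl,
      ← Measure.map_map (by fun_prop) (by fun_prop), gaussianReal_map_const_mul,
      gaussianReal_map_const_add]
    congr 1
    · simp
    · ext; simp
  have (i : ι) : SigmaFinite ((gaussianReal ((0 : ι → ℝ) i) 1).map
      fun x => m i + √(v : ℝ) * x) := hscale i ▸ inferInstance
  have hpi := Measure.pi_map_pi (μ := fun i => gaussianReal ((0 : ι → ℝ) i) 1)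
    (f := fun i x => m i + √(v : ℝ) * x) fun i => by fun_prop
  simp only [Pi.zero_apply, hscale] at hpi
  exact hpi

lemma hasLaw_eval_piGaussian (m : ι → ℝ) (v : ℝ≥0) (i : ι) :
    HasLaw (fun y : ι → ℝ => y i) (gaussianReal (m i) v) (piGaussian m v) :=
  ⟨(measurable_pi_apply i).aemeasurable,
    (measurePreserving_eval (fun i => gaussianReal (m i) v) i).map_eq⟩

lemma iIndepFun_eval_piGaussian (m : ι → ℝ) (v : ℝ≥0) :
    iIndepFun (fun i (y : ι → ℝ) => y i) (piGaussian m v) :=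
  iIndepFun_pi (μ := fun i => gaussianReal (m i) v) (X := fun _ x => x) fun _ => aemeasurable_id

lemma memLp_eval_piGaussian (m : ι → ℝ) (v : ℝ≥0) (i : ι) :
    MemLp (fun y : ι → ℝ => y i) 2 (piGaussian m v) :=
  (memLp_id_gaussianReal 2).comp_measurePreserving (measurePreserving_eval _ i)

lemma integral_eval_piGaussian (m : ι → ℝ) (v : ℝ≥0) (i : ι) :
    ∫ y, y i ∂(piGaussian m v) = m i := by
  rw [(hasLaw_eval_piGaussian m v i).integral_eq, integral_id_gaussianReal]

lemma covariance_eval_piGaussian [DecidableEq ι] (m : ι → ℝ) (v : ℝ≥0) (i j : ι) :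
    cov[fun y => y i, fun y => y j; piGaussian m v] = if i = j then (v : ℝ) else 0 := by
  split_ifs with h
  · rw [h, covariance_self (measurable_pi_apply j).aemeasurable,
      (hasLaw_eval_piGaussian m v j).variance_eq, variance_id_gaussianReal]
  · exact ((iIndepFun_eval_piGaussian m v).indepFun h).covariance_eq_zero
      (memLp_eval_piGaussian m v i) (memLp_eval_piGaussian m v j)

lemma indepFun_mulVec_piGaussian {κ τ : Type*} [Finite κ] [Finite τ] (m : ι → ℝ) (v : ℝ≥0)
    {A : Matrix κ ι ℝ} {B : Matrix τ ι ℝ} (hAB : A * Bᵀ = 0) :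
    IndepFun (fun y => A *ᵥ y) (fun y => B *ᵥ y) (piGaussian m v) := by
  classical
  cases nonempty_fintype κ
  cases nonempty_fintype τ
  have hgauss : HasGaussianLaw (fun y : ι → ℝ => fun i => y i) (piGaussian m v) :=
    (iIndepFun_eval_piGaussian m v).hasGaussianLaw fun i =>
      ⟨(hasLaw_eval_piGaussian m v i).map_eq ▸ inferInstance⟩
  refine (hgauss.map ((LinearMap.toContinuousLinearMap A.mulVecLin).prod
    (LinearMap.toContinuousLinearMap B.mulVecLin))).indepFun_of_covariance_eval
    (X := fun i y => (A *ᵥ y) i) (Y := fun j y => (B *ᵥ y) j) fun i j => ?_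
  simp_rw [mulVec, dotProduct]
  rw [covariance_fun_sum_fun_sum (fun a => (memLp_eval_piGaussian m v a).const_mul _)
    fun a => (memLp_eval_piGaussian m v a).const_mul _]
  simp_rw [covariance_const_mul_left, covariance_const_mul_right, covariance_eval_piGaussian,
    mul_ite, mul_zero, Finset.sum_ite_eq, Finset.mem_univ, if_true]
  calc ∑ x, A i x * (B j x * (v : ℝ)) = (A * Bᵀ) i j * v := by
        simp only [mul_apply, transpose_apply, Finset.sum_mul, mul_assoc]
    _ = 0 := by rw [hAB, Matrix.zero_apply, zero_mul]

lemma integral_eval_mul_eval_piGaussian [DecidableEq ι] (m c : ι → ℝ) (v : ℝ≥0) (i j : ι) :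
    ∫ y, (y i - c i) * (y j - c j) ∂(piGaussian m v) =
      (if i = j then (v : ℝ) else 0) + (m i - c i) * (m j - c j) := by
  have hLp (i : ι) := memLp_eval_piGaussian m v i
  have hmean (i : ι) : ∫ y, (y i - c i) ∂(piGaussian m v) = m i - c i := by
    rw [integral_sub ((hLp i).integrable one_le_two) (integrable_const _),
      integral_eval_piGaussian, integral_const, probReal_univ, one_smul]
  have hcov := covariance_eq_sub ((hLp i).sub (memLp_const (c i)))
    ((hLp j).sub (memLp_const (c j)))
  simp only [Pi.sub_def, Pi.mul_apply] at hcov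
  rw [covariance_sub_const_left ((hLp i).integrable one_le_two),
    covariance_sub_const_right ((hLp j).integrable one_le_two),
    covariance_eval_piGaussian, hmean, hmean] at hcov
  rw [hcov, sub_add_cancel]

variable {n : ℕ} {P : Matrix (Fin n) (Fin n) ℝ} {m : Fin n → ℝ} {v : ℝ≥0}

lemma integrable_eval_mul_eval_piGaussian (m c : ι → ℝ) (v : ℝ≥0) (i j : ι) :
    Integrable (fun y => (y i - c i) * (y j - c j)) (piGaussian m v) :=
  ((memLp_eval_piGaussian m v i).sub (memLp_const _)).integrable_mul
    ((memLp_eval_piGaussian m v j).sub (memLp_const _))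

lemma integrable_quadForm_piGaussian (m c : Fin n → ℝ) (v : ℝ≥0)
    (V : Matrix (Fin n) (Fin n) ℝ) :
    Integrable (fun y => quadForm V (y - c)) (piGaussian m v) := by
  simp only [quadForm_eq_sum, Pi.sub_apply]
  exact integrable_finsetSum _ fun i _ => integrable_finsetSum _ fun j _ =>
    (integrable_eval_mul_eval_piGaussian m c v i j).const_mul _

lemma integral_quadForm_piGaussian (m c : Fin n → ℝ) (v : ℝ≥0) (V : Matrix (Fin n) (Fin n) ℝ) :
    ∫ y, quadForm V (y - c) ∂(piGaussian m v) = v * V.trace + quadForm V (m - c) := by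
  have hint (i j : Fin n) :=
    (integrable_eval_mul_eval_piGaussian m c v i j).const_mul (V i j)
  simp only [quadForm_eq_sum, Pi.sub_apply]
  rw [integral_finsetSum _ fun i _ => integrable_finsetSum _ fun j _ => hint i j]
  simp only [integral_finsetSum _ fun j _ => hint _ j, integral_const_mul,
    integral_eval_mul_eval_piGaussian, mul_add, Finset.sum_add_distrib]
  congr 1
  simp [trace, Finset.mul_sum, mul_comm]

lemma lintegral_quadForm_piGaussian {V : Matrix (Fin n) (Fin n) ℝ} (hV : V.PosSemidef)
    (m c : Fin n → ℝ) (v : ℝ≥0) :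
    ∫⁻ y, ENNReal.ofReal (quadForm V (y - c)) ∂(piGaussian m v) =
      ENNReal.ofReal (v * V.trace + quadForm V (m - c)) := by
  rw [← integral_quadForm_piGaussian, ofReal_integral_eq_lintegral_ofReal
    (integrable_quadForm_piGaussian m c v V) (.of_forall fun y => quadForm_nonneg hV _)]

lemma indepFun_quadForm_piGaussian {Q : Matrix (Fin n) (Fin n) ℝ} (hP : IsStarProjection P)
    (hQ : IsStarProjection Q) (hPQ : P * Q = 0) (m c : Fin n → ℝ) (v : ℝ≥0) :
    IndepFun (quadForm P) (fun y => quadForm Q (y - c)) (piGaussian m v) := by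
  have hPQt : P * Qᵀ = 0 := by rw [transpose_eq_of_isStarProjection hQ, hPQ]
  have hind := (indepFun_mulVec_piGaussian m v hPQt).comp
    (φ := fun u => u ⬝ᵥ u) (ψ := fun u => (u - Q *ᵥ c) ⬝ᵥ (u - Q *ᵥ c))
    (Continuous.measurable (by fun_prop)) (Continuous.measurable (by fun_prop))
  simpa only [Function.comp_def, ← mulVec_sub, ← quadForm_eq_mulVec_dotProduct_mulVec hP,
    ← quadForm_eq_mulVec_dotProduct_mulVec hQ] using hind

lemma norm_orthogonalProjectionOnto_range_sq (hP : IsStarProjection P) (z : Fin n → ℝ) :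
    ‖(toEuclideanCLM (𝕜 := ℝ) P).range.orthogonalProjectionOnto (WithLp.toLp 2 z)‖ ^ 2 =
      quadForm P z := by
  obtain ⟨_, hproj⟩ :=
    isStarProjection_iff_eq_starProjection_range.1 (hP.map (toEuclideanCLM (𝕜 := ℝ)))
  rw [← Submodule.norm_coe, ← Submodule.starProjection_apply, ← hproj, toEuclideanCLM_toLp,
    EuclideanSpace.real_norm_sq_eq, quadForm_eq_mulVec_dotProduct_mulVec hP]
  simp only [dotProduct, sq]

lemma finrank_range_toEuclideanCLM (hP : IsIdempotentElem P) :
    (Module.finrank ℝ (toEuclideanCLM (𝕜 := ℝ) P).range : ℝ) = P.trace := by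
  have hidem : IsIdempotentElem (toEuclideanCLM (𝕜 := ℝ) P).toLinearMap :=
    ContinuousLinearMap.isIdempotentElem_toLinearMap_iff.2 (hP.map (toEuclideanCLM (𝕜 := ℝ)))
  rw [← (LinearMap.IsIdempotentElem.isProj_range _ hidem).trace, ← trace_toLin'_eq P,
    ← LinearMap.trace_conj' _ (WithLp.linearEquiv 2 ℝ (Fin n → ℝ)).symm]
  rfl

lemma stdGaussian_map_orthogonalProjectionOnto {E : Type*} [NormedAddCommGroup E]
    [InnerProductSpace ℝ E] [FiniteDimensional ℝ E] [MeasurableSpace E] [BorelSpace E]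
    (K : Submodule ℝ E) :
    (stdGaussian E).map K.orthogonalProjectionOnto = stdGaussian K := by
  have := Measure.isProbabilityMeasure_map (μ := stdGaussian E)
    (f := K.orthogonalProjectionOnto) (by fun_prop)
  refine Measure.ext_of_charFun (funext fun t => ?_)
  rw [charFun_apply, integral_map (by fun_prop) (by fun_prop)]
  simp_rw [Submodule.inner_orthogonalProjectionOnto_eq_of_mem_right]
  rw [← charFun_apply, charFun_stdGaussian, charFun_stdGaussian, Submodule.coe_norm]

/- Cochran: `P *ᵥ z` is the orthogonal projection of a standard Gaussian vector on the range of `P`,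
hence a standard Gaussian vector of a space of dimension `tr P`. -/
lemma hasLaw_quadForm_piGaussian_zero_one (hP : IsStarProjection P) (htr : 0 < P.trace) :
    HasLaw (quadForm P) (gammaMeasure (P.trace / 2) (1 / 2)) (piGaussian (0 : Fin n → ℝ) 1) := by
  have hdim := finrank_range_toEuclideanCLM hP.isIdempotentElem
  have hlaw := hasLaw_norm_sq_stdGaussian
    (E := (toEuclideanCLM (𝕜 := ℝ) P).range) (by exact_mod_cast hdim ▸ htr)
  refine ⟨by fun_prop, ?_⟩
  rw [← hdim, ← hlaw.map_eq, ← stdGaussian_map_orthogonalProjectionOnto,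
    Measure.map_map (by fun_prop) (by fun_prop), ← map_pi_eq_stdGaussian,
    Measure.map_map (by fun_prop) (by fun_prop)]
  exact congrArg (Measure.map · _)
    (funext fun z => (norm_orthogonalProjectionOnto_range_sq hP z).symm)

lemma hasLaw_quadForm_piGaussian (hP : IsStarProjection P) (htr : 0 < P.trace)
    (hm : P *ᵥ m = 0) (hv : 0 < v) :
    HasLaw (quadForm P) (gammaMeasure (P.trace / 2) (1 / (2 * v))) (piGaussian m v) := by
  refine ⟨by fun_prop, ?_⟩
  rw [← div_div, ← gammaMeasure_map_const_mul (by positivity) one_half_pos (NNReal.coe_pos.2 hv),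
    ← (hasLaw_quadForm_piGaussian_zero_one hP htr).map_eq, ← map_piGaussian_zero_one m v,
    Measure.map_map (by fun_prop) (by fun_prop), Measure.map_map (by fun_prop) (by fun_prop)]
  refine congrArg (Measure.map · _) (funext fun z => ?_)
  simp only [Function.comp_apply, quadForm_add_of_mulVec_eq_zero hP hm, quadForm_smul,
    Real.sq_sqrt v.coe_nonneg]

lemma integrable_comp_iff_of_hasLaw {Ω 𝓧 : Type*} [MeasurableSpace Ω] [MeasurableSpace 𝓧]
    {μ : Measure Ω} {ν : Measure 𝓧} {X : Ω → 𝓧} (hX : HasLaw X ν μ) {f : 𝓧 → ℝ}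
    (hf : AEStronglyMeasurable f ν) :
    Integrable (fun ω => f (X ω)) μ ↔ Integrable f ν := by
  rw [← hX.map_eq] at hf ⊢
  exact (integrable_map_measure hf hX.aemeasurable).symm

lemma ae_quadForm_pos_piGaussian (hP : IsStarProjection P) (htr : 0 < P.trace)
    (hm : P *ᵥ m = 0) (hv : 0 < v) : ∀ᵐ y ∂(piGaussian m v), 0 < quadForm P y :=
  ((hasLaw_quadForm_piGaussian hP htr hm hv).ae_iff
    (measurableSet_setOfPred.1 measurableSet_Ioi)).2 (ae_pos_gammaMeasure _ _)

lemma integrable_log_quadForm_piGaussian (hP : IsStarProjection P) (htr : 0 < P.trace)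
    (hm : P *ᵥ m = 0) (hv : 0 < v) :
    Integrable (fun y => Real.log (quadForm P y)) (piGaussian m v) :=
  (integrable_comp_iff_of_hasLaw (hasLaw_quadForm_piGaussian hP htr hm hv)
    Real.measurable_log.aestronglyMeasurable).2
    (integrable_log_gammaMeasure (by positivity) (by positivity))

lemma integral_log_quadForm_piGaussian (hP : IsStarProjection P) (htr : 0 < P.trace)
    (hm : P *ᵥ m = 0) (hv : 0 < v) :
    ∫ y, Real.log (quadForm P y) ∂(piGaussian m v) =
      (Complex.digamma (P.trace / 2)).re + Real.log 2 + Real.log v := by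
  have hv' : (v : ℝ) ≠ 0 := by positivity
  refine ((hasLaw_quadForm_piGaussian hP htr hm hv).integral_comp
    Real.measurable_log.aestronglyMeasurable).trans ?_
  rw [integral_log_gammaMeasure (by positivity) (by positivity), one_div, Real.log_inv,
    Real.log_mul two_ne_zero hv']
  push_cast
  ring

lemma integrable_inv_quadForm_piGaussian_iff (hP : IsStarProjection P) (htr : 0 < P.trace)
    (hm : P *ᵥ m = 0) (hv : 0 < v) :
    Integrable (fun y => (quadForm P y)⁻¹) (piGaussian m v) ↔ 2 < P.trace := by
  rw [← one_lt_div two_pos, ← integrable_inv_gammaMeasure_iff (by positivity)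
    (by positivity : (0 : ℝ) < 1 / (2 * v))]
  exact integrable_comp_iff_of_hasLaw (hasLaw_quadForm_piGaussian hP htr hm hv)
    measurable_inv.aestronglyMeasurable

lemma integral_inv_quadForm_piGaussian (hP : IsStarProjection P) (htr : 2 < P.trace)
    (hm : P *ᵥ m = 0) (hv : 0 < v) :
    ∫ y, (quadForm P y)⁻¹ ∂(piGaussian m v) = 1 / (v * (P.trace - 2)) := by
  refine ((hasLaw_quadForm_piGaussian hP (by linarith) hm hv).integral_comp
    measurable_inv.aestronglyMeasurable).trans ?_
  refine (integral_inv_gammaMeasure (by linarith) (by positivity)).trans ?_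
  have hv' : (v : ℝ) ≠ 0 := by positivity
  have htr' : P.trace - 2 ≠ 0 := by linarith
  field_simp

end PiGaussian

section GaussianKernel

section LinearSubstitution

variable {ι F : Type*} [Fintype ι] [DecidableEq ι] [NormedAddCommGroup F] {B : Matrix ι ι ℝ}

lemma measurableEmbedding_mulVec (hB : B.det ≠ 0) : MeasurableEmbedding (B *ᵥ ·) :=
  Continuous.measurableEmbedding (by fun_prop)
    (mulVec_injective_iff_isUnit.2 ((isUnit_iff_isUnit_det B).2 (isUnit_iff_ne_zero.2 hB)))

lemma map_mulVec_volume (hB : B.det ≠ 0) :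
    volume.map (B *ᵥ ·) = ENNReal.ofReal |B.det⁻¹| • (volume : Measure (ι → ℝ)) :=
  Real.map_matrix_volume_pi_eq_smul_volume_pi hB

lemma integrable_comp_mulVec_iff (hB : B.det ≠ 0) {h : (ι → ℝ) → F} :
    Integrable (fun t => h (B *ᵥ t)) ↔ Integrable h := by
  have hdet : ENNReal.ofReal |B.det⁻¹| ≠ 0 := by simpa using hB
  rw [← integrable_smul_measure (μ := volume) (f := h) hdet ENNReal.ofReal_ne_top,
    ← map_mulVec_volume hB, (measurableEmbedding_mulVec hB).integrable_map_iff, Function.comp_def]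

lemma integral_comp_mulVec [NormedSpace ℝ F] (hB : B.det ≠ 0) (h : (ι → ℝ) → F) :
    ∫ t, h (B *ᵥ t) = |B.det⁻¹| • ∫ u, h u := by
  rw [← (measurableEmbedding_mulVec hB).integral_map, map_mulVec_volume hB,
    integral_smul_measure, ENNReal.toReal_ofReal (abs_nonneg _)]

open scoped MatrixOrder in
lemma exists_det_ne_zero_eq_transpose_mul_self {V : Matrix ι ι ℝ} (hV : V.PosDef) :
    ∃ B : Matrix ι ι ℝ, B.det ≠ 0 ∧ V = Bᵀ * B := by
  obtain ⟨B, hB, h⟩ := CStarAlgebra.isStrictlyPositive_iff_eq_star_mul_self.1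
    hV.isStrictlyPositive
  refine ⟨B, ((isUnit_iff_isUnit_det B).1 hB).ne_zero, ?_⟩
  rwa [star_eq_conjTranspose, conjTranspose_eq_transpose_of_trivial] at h

end LinearSubstitution

section Standard

variable {ι : Type*} [Fintype ι] {w : ℝ}

lemma integral_exp_neg_mul_dotProduct_self (hw : 0 < w) :
    ∫ u : ι → ℝ, Real.exp (-(w * (u ⬝ᵥ u))) = (Real.pi / w) ^ (Fintype.card ι / 2 : ℝ) := by
  have h := GaussianFourier.integral_rexp_neg_mul_sq_norm (V := EuclideanSpace ℝ ι) hw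
  rw [← (PiLp.volume_preserving_toLp ι).integral_comp
    (MeasurableEquiv.toLp 2 _).measurableEmbedding] at h
  simpa only [EuclideanSpace.real_norm_sq_eq, finrank_euclideanSpace, dotProduct, ← sq,
    neg_mul] using h

lemma integrable_exp_neg_mul_dotProduct_self (hw : 0 < w) :
    Integrable fun u : ι → ℝ => Real.exp (-(w * (u ⬝ᵥ u))) := by
  refine not_imp_comm.1 integral_undef ?_
  rw [integral_exp_neg_mul_dotProduct_self hw]
  have := Real.pi_pos
  positivity

lemma norm_sq_le_dotProduct_self (u : ι → ℝ) : ‖u‖ ^ 2 ≤ u ⬝ᵥ u := by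
  have hnonneg : 0 ≤ u ⬝ᵥ u := Finset.sum_nonneg fun i _ => mul_self_nonneg _
  rw [← Real.le_sqrt (norm_nonneg u) hnonneg, pi_norm_le_iff_of_nonneg (Real.sqrt_nonneg _)]
  intro i
  refine Real.abs_le_sqrt ?_
  rw [sq]
  exact Finset.single_le_sum (f := fun i => u i * u i) (fun i _ => mul_self_nonneg _)
    (Finset.mem_univ i)

/- AM-GM: `x ≤ 1 / (2 * w) + w / 2 * x ^ 2`, and `x ≤ exp x`. -/
lemma le_exp_mul_exp_mul_sq (hw : 0 < w) (x : ℝ) :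
    x ≤ Real.exp (1 / (2 * w)) * Real.exp (w / 2 * x ^ 2) := by
  have hamgm : x ≤ 1 / (2 * w) + w / 2 * x ^ 2 := by
    have : 1 / (2 * w) + w / 2 * x ^ 2 - x = (w * x - 1) ^ 2 / (2 * w) := by
      field_simp
      ring
    have : 0 ≤ (w * x - 1) ^ 2 / (2 * w) := by positivity
    linarith
  calc x ≤ Real.exp x := by linarith [Real.add_one_le_exp x]
    _ ≤ Real.exp (1 / (2 * w) + w / 2 * x ^ 2) := Real.exp_le_exp.2 hamgm
    _ = _ := Real.exp_add _ _

lemma integrable_exp_neg_mul_dotProduct_self_smul (hw : 0 < w) :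
    Integrable fun u : ι → ℝ => Real.exp (-(w * (u ⬝ᵥ u))) • u := by
  refine ((integrable_exp_neg_mul_dotProduct_self (half_pos hw)).const_mul
    (Real.exp (1 / (2 * w)))).mono' (by fun_prop) (.of_forall fun u => ?_)
  rw [norm_smul, Real.norm_of_nonneg (Real.exp_pos _).le]
  calc Real.exp (-(w * (u ⬝ᵥ u))) * ‖u‖
      ≤ Real.exp (-(w * (u ⬝ᵥ u))) *
        (Real.exp (1 / (2 * w)) * Real.exp (w / 2 * (u ⬝ᵥ u))) := by
        gcongr
        refine (le_exp_mul_exp_mul_sq hw ‖u‖).trans ?_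
        gcongr
        exact norm_sq_le_dotProduct_self u
    _ = Real.exp (1 / (2 * w)) * Real.exp (-(w / 2 * (u ⬝ᵥ u))) := by
        rw [mul_left_comm, ← Real.exp_add]
        ring_nf

end Standard

variable {p : ℕ} {V : Matrix (Fin p) (Fin p) ℝ} {w : ℝ}

lemma integrable_exp_neg_mul_quadForm (hV : V.PosDef) (hw : 0 < w) :
    Integrable fun t => Real.exp (-(w * quadForm V t)) := by
  obtain ⟨B, hB, rfl⟩ := exists_det_ne_zero_eq_transpose_mul_self hV
  simp only [quadForm_transpose_mul_self]
  exact (integrable_comp_mulVec_iff hB).2 (integrable_exp_neg_mul_dotProduct_self hw)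

lemma integral_exp_neg_mul_quadForm (hV : V.PosDef) (hw : 0 < w) :
    ∫ t, Real.exp (-(w * quadForm V t)) = (Real.pi / w) ^ (p / 2 : ℝ) / √V.det := by
  obtain ⟨B, hB, rfl⟩ := exists_det_ne_zero_eq_transpose_mul_self hV
  simp only [quadForm_transpose_mul_self]
  rw [integral_comp_mulVec hB fun u => Real.exp (-(w * (u ⬝ᵥ u))),
    integral_exp_neg_mul_dotProduct_self hw, Fintype.card_fin, det_mul, det_transpose,
    Real.sqrt_mul_self_eq_abs, abs_inv, smul_eq_mul, inv_mul_eq_div]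

lemma integrable_exp_neg_mul_quadForm_smul (hV : V.PosDef) (hw : 0 < w) :
    Integrable fun t => Real.exp (-(w * quadForm V t)) • t := by
  obtain ⟨B, hB, rfl⟩ := exists_det_ne_zero_eq_transpose_mul_self hV
  have h := (LinearMap.toContinuousLinearMap B⁻¹.mulVecLin).integrable_comp
    ((integrable_comp_mulVec_iff hB).2 (integrable_exp_neg_mul_dotProduct_self_smul hw))
  simpa only [LinearMap.coe_toContinuousLinearMap', mulVecLin_apply, mulVec_smul, mulVec_mulVec,
    nonsing_inv_mul B (isUnit_iff_ne_zero.2 hB), one_mulVec, quadForm_transpose_mul_self] using h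

lemma integral_exp_neg_mul_quadForm_smul (V : Matrix (Fin p) (Fin p) ℝ) (w : ℝ) :
    ∫ t, Real.exp (-(w * quadForm V t)) • t = 0 := by
  have h := integral_neg_eq_self (fun t : Fin p → ℝ => Real.exp (-(w * quadForm V t)) • t) volume
  simp only [quadForm_neg, smul_neg, integral_neg] at h
  exact self_eq_neg.1 h.symm

end GaussianKernel

section QuadraticLoss

variable {p : ℕ} {V : Matrix (Fin p) (Fin p) ℝ} {loss : (Fin p → ℝ) → ℝ} {c w : ℝ}
  {m : Fin p → ℝ}

lemma gibbsKernel_quadratic (hloss : ∀ t, loss t = c + quadForm V (t - m)) (t : Fin p → ℝ) :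
    gibbsKernel w loss (fun _ => 1) t =
      Real.exp (-(w * c)) * Real.exp (-(w * quadForm V (t - m))) := by
  rw [gibbsKernel, hloss, mul_one, ← Real.exp_add]
  ring_nf

lemma integrable_gibbsKernel_quadratic (hV : V.PosDef)
    (hloss : ∀ t, loss t = c + quadForm V (t - m)) (hw : 0 < w) :
    Integrable (gibbsKernel w loss fun _ => 1) := by
  rw [funext (gibbsKernel_quadratic hloss)]
  exact ((integrable_exp_neg_mul_quadForm hV hw).comp_sub_right m).const_mul _

lemma integral_gibbsKernel_quadratic (hV : V.PosDef)
    (hloss : ∀ t, loss t = c + quadForm V (t - m)) (hw : 0 < w) :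
    ∫ t, gibbsKernel w loss (fun _ => 1) t =
      Real.exp (-(w * c)) * ((Real.pi / w) ^ (p / 2 : ℝ) / √V.det) := by
  simp only [gibbsKernel_quadratic hloss]
  rw [integral_const_mul, integral_sub_right_eq_self (fun t => Real.exp (-(w * quadForm V t))) m,
    integral_exp_neg_mul_quadForm hV hw]

lemma gibbsPosteriorExists_quadratic_iff (hV : V.PosDef)
    (hloss : ∀ t, loss t = c + quadForm V (t - m)) :
    GibbsPosteriorExists w loss (fun _ => 1) ↔ 0 < w := by
  refine ⟨fun h => h.1, fun hw => ?_⟩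
  have hnorm := ofReal_integral_eq_lintegral_ofReal
    (integrable_gibbsKernel_quadratic hV hloss hw)
    (.of_forall fun t => by rw [gibbsKernel, mul_one]; positivity)
  refine ⟨hw, ?_, hnorm ▸ ENNReal.ofReal_ne_top⟩
  rw [← hnorm, integral_gibbsKernel_quadratic hV hloss hw, ENNReal.ofReal_ne_zero_iff]
  have := hV.det_pos
  have := Real.pi_pos
  positivity

lemma gibbsPdf_quadratic (hV : V.PosDef) (hloss : ∀ t, loss t = c + quadForm V (t - m))
    (hw : 0 < w) (t : Fin p → ℝ) :
    gibbsPdf w loss (fun _ => 1) t =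
      ((Real.pi / w) ^ (p / 2 : ℝ) / √V.det)⁻¹ * Real.exp (-(w * quadForm V (t - m))) := by
  rw [gibbsPdf, integral_gibbsKernel_quadratic hV hloss hw, gibbsKernel_quadratic hloss,
    mul_div_mul_left _ _ (Real.exp_pos _).ne', inv_mul_eq_div]

lemma log_gibbsPdf_quadratic (hV : V.PosDef) (hloss : ∀ t, loss t = c + quadForm V (t - m))
    (hw : 0 < w) (t : Fin p → ℝ) :
    Real.log (gibbsPdf w loss (fun _ => 1) t) =
      1 / 2 * Real.log V.det - p / 2 * Real.log (Real.pi / w) - w * quadForm V (t - m) := by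
  have hdet := hV.det_pos
  have := Real.pi_pos
  rw [gibbsPdf_quadratic hV hloss hw, Real.log_mul (by positivity) (by positivity), Real.log_exp,
    Real.log_inv, Real.log_div (by positivity) (by positivity), Real.log_rpow (by positivity),
    Real.log_sqrt hdet.le]
  ring

lemma gibbsMean_quadratic (hV : V.PosDef) (hloss : ∀ t, loss t = c + quadForm V (t - m))
    (hw : 0 < w) : gibbsMean w loss (fun _ => 1) = m := by
  set k := (Real.pi / w) ^ (p / 2 : ℝ) / √V.det with hk
  have hk0 : 0 < k := by
    have := hV.det_pos
    have := Real.pi_pos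
    positivity
  have hpdf := gibbsPdf_quadratic hV hloss hw
  have hmeas : Measurable (gibbsPdf w loss fun _ => 1) := by
    rw [funext hpdf]
    fun_prop
  calc gibbsMean w loss (fun _ => 1)
      = ∫ t, gibbsPdf w loss (fun _ => 1) t • t := by
        rw [gibbsMean, gibbsPosterior, integral_withDensity_eq_integral_toReal_smul
          (by fun_prop) (by simp)]
        refine integral_congr_ae (.of_forall fun t => ?_)
        have hnonneg : 0 ≤ gibbsPdf w loss (fun _ => 1) t := by
          rw [hpdf]
          positivity
        simp only [ENNReal.toReal_ofReal hnonneg]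
    _ = k⁻¹ • ∫ t, Real.exp (-(w * quadForm V t)) • (t + m) := by
        rw [← integral_sub_right_eq_self
          (fun t => Real.exp (-(w * quadForm V t)) • (t + m)) m, ← integral_smul]
        simp only [hpdf, ← hk, smul_smul, sub_add_cancel]
    _ = k⁻¹ • k • m := by
        simp only [smul_add]
        rw [integral_add (integrable_exp_neg_mul_quadForm_smul hV hw)
          ((integrable_exp_neg_mul_quadForm hV hw).smul_const m),
          integral_exp_neg_mul_quadForm_smul, integral_smul_const,
          integral_exp_neg_mul_quadForm hV hw, zero_add]
    _ = m := inv_smul_smul₀ hk0.ne' m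

end QuadraticLoss

section LeastSquares

variable {κ ι : Type*} [Fintype κ] [Fintype ι] [DecidableEq ι] {Z : Matrix κ ι ℝ}

/-- The coefficient matrix of the ordinary least squares estimator in the linear model with model
matrix `Z`; it is meaningful only if the Gram matrix `Zᵀ * Z` is invertible. -/
def olsMatrix (Z : Matrix κ ι ℝ) : Matrix ι κ ℝ := (Zᵀ * Z)⁻¹ * Zᵀ

/-- The hat matrix of the linear model with model matrix `Z`, that is the orthogonal projection on
the column space of `Z`; it is meaningful only if the Gram matrix `Zᵀ * Z` is invertible. -/
def hatMatrix (Z : Matrix κ ι ℝ) : Matrix κ κ ℝ := Z * (Zᵀ * Z)⁻¹ * Zᵀ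

lemma posDef_transpose_mul_self (hZ : (Zᵀ * Z).det ≠ 0) : (Zᵀ * Z).PosDef := by
  have h := posSemidef_conjTranspose_mul_self Z
  rw [conjTranspose_eq_transpose_of_trivial] at h
  exact h.posDef_iff_det_ne_zero.2 hZ

lemma mul_olsMatrix (Z : Matrix κ ι ℝ) : Z * olsMatrix Z = hatMatrix Z :=
  (Matrix.mul_assoc _ _ _).symm

lemma olsMatrix_mul_self (hZ : (Zᵀ * Z).det ≠ 0) : olsMatrix Z * Z = 1 := by
  rw [olsMatrix, Matrix.mul_assoc, nonsing_inv_mul _ (isUnit_iff_ne_zero.2 hZ)]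

lemma hatMatrix_mul_self (hZ : (Zᵀ * Z).det ≠ 0) : hatMatrix Z * Z = Z := by
  rw [← mul_olsMatrix, Matrix.mul_assoc, olsMatrix_mul_self hZ, Matrix.mul_one]

lemma hatMatrix_transpose (Z : Matrix κ ι ℝ) : (hatMatrix Z)ᵀ = hatMatrix Z := by
  simp only [hatMatrix, transpose_mul, transpose_nonsing_inv, transpose_transpose,
    Matrix.mul_assoc]

lemma isStarProjection_hatMatrix (hZ : (Zᵀ * Z).det ≠ 0) : IsStarProjection (hatMatrix Z) where
  isIdempotentElem := by
    rw [IsIdempotentElem]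
    nth_rw 2 [← mul_olsMatrix]
    rw [← Matrix.mul_assoc, hatMatrix_mul_self hZ, mul_olsMatrix]
  isSelfAdjoint := by
    rw [IsSelfAdjoint, star_eq_conjTranspose, conjTranspose_eq_transpose_of_trivial,
      hatMatrix_transpose]

lemma trace_hatMatrix (hZ : (Zᵀ * Z).det ≠ 0) : (hatMatrix Z).trace = Fintype.card ι := by
  rw [← mul_olsMatrix, trace_mul_comm, olsMatrix_mul_self hZ, trace_one]

lemma olsMatrix_mul_transpose_self (hZ : (Zᵀ * Z).det ≠ 0) :
    olsMatrix Z * (olsMatrix Z)ᵀ = (Zᵀ * Z)⁻¹ := by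
  nth_rw 2 [olsMatrix]
  rw [transpose_mul, transpose_transpose, transpose_nonsing_inv, transpose_mul,
    transpose_transpose, ← Matrix.mul_assoc, olsMatrix_mul_self hZ, Matrix.one_mul]

lemma transpose_mulVec_sub_mulVec_olsMatrix (hZ : (Zᵀ * Z).det ≠ 0) (y : κ → ℝ) :
    Zᵀ *ᵥ (y - Z *ᵥ (olsMatrix Z *ᵥ y)) = 0 := by
  have h := congrArg transpose (hatMatrix_mul_self hZ)
  rw [transpose_mul, hatMatrix_transpose] at h
  rw [mulVec_sub, mulVec_mulVec _ Z, mul_olsMatrix, mulVec_mulVec, h, sub_self]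

lemma sub_mulVec_dotProduct_self (hZ : (Zᵀ * Z).det ≠ 0) (y : κ → ℝ) (t : ι → ℝ) :
    (y - Z *ᵥ t) ⬝ᵥ (y - Z *ᵥ t) =
      (y - Z *ᵥ (olsMatrix Z *ᵥ y)) ⬝ᵥ (y - Z *ᵥ (olsMatrix Z *ᵥ y)) +
        (Z *ᵥ (t - olsMatrix Z *ᵥ y)) ⬝ᵥ (Z *ᵥ (t - olsMatrix Z *ᵥ y)) := by
  have hsplit : y - Z *ᵥ t = (y - Z *ᵥ (olsMatrix Z *ᵥ y)) - Z *ᵥ (t - olsMatrix Z *ᵥ y) := by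
    rw [mulVec_sub, sub_sub_sub_cancel_right]
  have horth : (y - Z *ᵥ (olsMatrix Z *ᵥ y)) ⬝ᵥ (Z *ᵥ (t - olsMatrix Z *ᵥ y)) = 0 := by
    rw [dotProduct_mulVec, ← mulVec_transpose, transpose_mulVec_sub_mulVec_olsMatrix hZ,
      zero_dotProduct]
  rw [hsplit]
  generalize y - Z *ᵥ (olsMatrix Z *ᵥ y) = residual, Z *ᵥ (t - olsMatrix Z *ᵥ y) = fit at horth ⊢
  rw [sub_dotProduct, dotProduct_sub, dotProduct_sub, dotProduct_comm fit residual, horth]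
  ring

lemma quadForm_hatMatrix {n : ℕ} {Z : Matrix (Fin n) ι ℝ} (hZ : (Zᵀ * Z).det ≠ 0)
    (y : Fin n → ℝ) :
    quadForm (hatMatrix Z) y = (Z *ᵥ (olsMatrix Z *ᵥ y)) ⬝ᵥ (Z *ᵥ (olsMatrix Z *ᵥ y)) := by
  rw [quadForm_eq_mulVec_dotProduct_mulVec (isStarProjection_hatMatrix hZ), mulVec_mulVec,
    mul_olsMatrix]

end LeastSquares

section Design

variable {𝕏 : Type*} {n p : ℕ} (X : Fin n → 𝕏)

lemma treatmentMatrix_transpose_mul_self [DecidableEq (Set.range X)] :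
    (treatmentMatrix X)ᵀ * treatmentMatrix X = diagonal fun j => ∑ i, treatmentMatrix X i j := by
  ext j k
  simp only [mul_apply, transpose_apply, treatmentMatrix, of_apply, diagonal_apply]
  split_ifs with hjk
  · exact Finset.sum_congr rfl fun i _ => by subst hjk; split_ifs <;> simp
  · refine Finset.sum_eq_zero fun i _ => ?_
    split_ifs with hj hk
    · exact absurd (Subtype.ext (hj.symm.trans hk)) hjk
    all_goals simp

lemma det_treatmentMatrix_transpose_mul_self_ne_zero [Fintype (Set.range X)]
    [DecidableEq (Set.range X)] : ((treatmentMatrix X)ᵀ * treatmentMatrix X).det ≠ 0 := by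
  have hnonneg (i : Fin n) (j : Set.range X) : 0 ≤ treatmentMatrix X i j := by
    rw [treatmentMatrix, of_apply]
    split_ifs <;> simp
  rw [treatmentMatrix_transpose_mul_self, det_diagonal, Finset.prod_ne_zero_iff]
  rintro ⟨_, i, rfl⟩ -
  refine (Finset.sum_pos' (fun k _ => hnonneg k _) ⟨i, Finset.mem_univ _, ?_⟩).ne'
  simp [treatmentMatrix]

lemma treatmentMatrix_mulVec [Fintype (Set.range X)] (g : 𝕏 → ℝ) :
    treatmentMatrix X *ᵥ (fun j => g j) = fun i => g (X i) := by
  ext i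
  simp only [mulVec, dotProduct, treatmentMatrix, of_apply]
  rw [Finset.sum_eq_single ⟨X i, i, rfl⟩]
  · simp
  · rintro j - hj
    rw [if_neg fun h => hj (Subtype.ext h.symm), zero_mul]
  · simp

lemma treatmentHat_mulVec (g : 𝕏 → ℝ) :
    treatmentHat X *ᵥ (fun i => g (X i)) = fun i => g (X i) := by
  classical
  rw [← treatmentMatrix_mulVec, mulVec_mulVec]
  exact congrArg (· *ᵥ _)
    (hatMatrix_mul_self (det_treatmentMatrix_transpose_mul_self_ne_zero X))

lemma isStarProjection_treatmentHat : IsStarProjection (treatmentHat X) := by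
  classical exact isStarProjection_hatMatrix (det_treatmentMatrix_transpose_mul_self_ne_zero X)

lemma trace_treatmentHat : (treatmentHat X).trace = numTreatments X := by
  classical
  rw [numTreatments, Set.ncard_eq_toFinset_card', Set.toFinset_card]
  exact trace_hatMatrix (det_treatmentMatrix_transpose_mul_self_ne_zero X)

lemma numTreatments_le : numTreatments X ≤ n := by
  rw [numTreatments, ← Set.image_univ]
  exact (Set.ncard_image_le).trans (by simp)

lemma numTreatments_pos (hn : 0 < n) : 0 < numTreatments X := by
  rw [numTreatments, Set.ncard_pos]
  exact ⟨X ⟨0, hn⟩, ⟨0, hn⟩, rfl⟩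

/-- The orthogonal projection on the complement of the unique-treatment model, whose quadratic form
is the pure error sum of squares. -/
def pureErrorProj : Matrix (Fin n) (Fin n) ℝ := 1 - treatmentHat X

lemma isStarProjection_pureErrorProj : IsStarProjection (pureErrorProj X) :=
  (isStarProjection_treatmentHat X).one_sub

lemma trace_pureErrorProj : (pureErrorProj X).trace = pureErrorDF X := by
  rw [pureErrorProj, trace_sub, trace_one, trace_treatmentHat, pureErrorDF,
    Nat.cast_sub (numTreatments_le X), Fintype.card_fin]

lemma pureErrorProj_mul_treatmentHat : pureErrorProj X * treatmentHat X = 0 :=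
  (isStarProjection_treatmentHat X).isIdempotentElem.one_sub_mul_self

lemma pureErrorProj_mulVec (g : 𝕏 → ℝ) : pureErrorProj X *ᵥ (fun i => g (X i)) = 0 := by
  rw [pureErrorProj, sub_mulVec, treatmentHat_mulVec, one_mulVec, sub_self]

lemma pureErrorProj_mul_modelMatrix (f : 𝕏 → Fin p → ℝ) :
    pureErrorProj X * modelMatrix f X = 0 := by
  ext i j
  exact congrFun (pureErrorProj_mulVec X fun x => f x j) i

lemma pureErrorProj_mul_hatMatrix_modelMatrix (f : 𝕏 → Fin p → ℝ) :
    pureErrorProj X * hatMatrix (modelMatrix f X) = 0 := by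
  rw [← mul_olsMatrix, ← Matrix.mul_assoc, pureErrorProj_mul_modelMatrix, Matrix.zero_mul]

lemma quadForm_pureErrorProj_add_quadForm_treatmentHat (u : Fin n → ℝ) :
    quadForm (pureErrorProj X) u + quadForm (treatmentHat X) u = u ⬝ᵥ u := by
  rw [quadForm, quadForm, ← dotProduct_add, ← add_mulVec, pureErrorProj, sub_add_cancel,
    one_mulVec]

lemma calibWeight_eq (y : Fin n → ℝ) :
    calibWeight X y = (pureErrorDF X : ℝ) / 2 * (quadForm (pureErrorProj X) y)⁻¹ := by
  rw [calibWeight, pureErrorVar, pureErrorProj, one_div, mul_inv, mul_inv, one_div, inv_inv]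
  ring

lemma measurable_calibWeight : Measurable (calibWeight X) := by
  rw [funext (calibWeight_eq X)]
  fun_prop

lemma calibWeight_nonneg (y : Fin n → ℝ) : 0 ≤ calibWeight X y := by
  rw [calibWeight_eq]
  have := quadForm_nonneg (posSemidef_of_isStarProjection (isStarProjection_pureErrorProj X)) y
  positivity

variable {X}

lemma calibWeight_pos (hd : 0 < pureErrorDF X) {y : Fin n → ℝ}
    (hy : 0 < quadForm (pureErrorProj X) y) : 0 < calibWeight X y := by
  rw [calibWeight_eq]
  positivity

lemma calibWeight_eq_zero (hd : pureErrorDF X = 0) (y : Fin n → ℝ) : calibWeight X y = 0 := by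
  rw [calibWeight_eq, hd, Nat.cast_zero, zero_div, zero_mul]

lemma calibWeight_mul_quadForm_pureErrorProj {y : Fin n → ℝ}
    (hy : quadForm (pureErrorProj X) y ≠ 0) :
    calibWeight X y * quadForm (pureErrorProj X) y = pureErrorDF X / 2 := by
  rw [calibWeight_eq, mul_assoc, inv_mul_cancel₀ hy, mul_one]

end Design

section Loss

variable {𝕏 : Type*} {n p : ℕ} (f : 𝕏 → Fin p → ℝ) (X : Fin n → 𝕏)

lemma ssLoss_eq_dotProduct (t : Fin p → ℝ) (y : Fin n → ℝ) :
    ssLoss f X t y = (y - modelMatrix f X *ᵥ t) ⬝ᵥ (y - modelMatrix f X *ᵥ t) :=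
  Finset.sum_congr rfl fun _ _ => sq _

lemma ssLoss_eq_quadForm_one (t : Fin p → ℝ) (y : Fin n → ℝ) :
    ssLoss f X t y = quadForm 1 (y - modelMatrix f X *ᵥ t) := by
  rw [ssLoss_eq_dotProduct, quadForm, one_mulVec]

lemma ssLoss_nonneg (t : Fin p → ℝ) (y : Fin n → ℝ) : 0 ≤ ssLoss f X t y :=
  Finset.sum_nonneg fun _ _ => sq_nonneg _

lemma ssLoss_eq_pureError_add_lackOfFit (t : Fin p → ℝ) (y : Fin n → ℝ) :
    ssLoss f X t y = quadForm (pureErrorProj X) y +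
      quadForm (treatmentHat X) (y - modelMatrix f X *ᵥ t) := by
  have hfit : pureErrorProj X *ᵥ (-(modelMatrix f X *ᵥ t)) = 0 := by
    rw [mulVec_neg, mulVec_mulVec, pureErrorProj_mul_modelMatrix, zero_mulVec, neg_zero]
  rw [ssLoss_eq_dotProduct, ← quadForm_pureErrorProj_add_quadForm_treatmentHat X,
    ← quadForm_add_of_mulVec_eq_zero (isStarProjection_pureErrorProj X) hfit y, neg_add_eq_sub]

variable {f X}

lemma ssLoss_eq_ssLoss_olsMatrix_add (hF : ((modelMatrix f X)ᵀ * modelMatrix f X).det ≠ 0)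
    (t : Fin p → ℝ) (y : Fin n → ℝ) :
    ssLoss f X t y = ssLoss f X (olsMatrix (modelMatrix f X) *ᵥ y) y +
      quadForm ((modelMatrix f X)ᵀ * modelMatrix f X)
        (t - olsMatrix (modelMatrix f X) *ᵥ y) := by
  rw [ssLoss_eq_dotProduct, sub_mulVec_dotProduct_self hF, ← ssLoss_eq_dotProduct,
    quadForm_transpose_mul_self]

lemma pos_of_det_modelMatrix_transpose_mul_self_ne_zero (hp : 0 < p)
    (hF : ((modelMatrix f X)ᵀ * modelMatrix f X).det ≠ 0) : 0 < n := by
  by_contra! hn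
  obtain rfl : n = 0 := by omega
  have : Nonempty (Fin p) := ⟨⟨0, hp⟩⟩
  have hgram : (modelMatrix f X)ᵀ * modelMatrix f X = 0 := by
    ext
    simp [mul_apply]
  exact hF (hgram ▸ det_zero)

end Loss

section CalibrationWeight

variable {𝕏 : Type*} {n : ℕ} {X : Fin n → 𝕏} {m : Fin n → ℝ} {v : ℝ≥0}

lemma trace_pureErrorProj_pos (hd : 0 < pureErrorDF X) : 0 < (pureErrorProj X).trace := by
  rw [trace_pureErrorProj]
  exact_mod_cast hd

lemma ae_quadForm_pureErrorProj_pos (hd : 0 < pureErrorDF X) (hm : pureErrorProj X *ᵥ m = 0)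
    (hv : 0 < v) : ∀ᵐ y ∂(piGaussian m v), 0 < quadForm (pureErrorProj X) y :=
  ae_quadForm_pos_piGaussian (isStarProjection_pureErrorProj X) (trace_pureErrorProj_pos hd) hm hv

lemma integrable_calibWeight_iff (hd : 0 < pureErrorDF X) (hm : pureErrorProj X *ᵥ m = 0)
    (hv : 0 < v) : Integrable (calibWeight X) (piGaussian m v) ↔ 2 < pureErrorDF X := by
  have hscale : IsUnit ((pureErrorDF X : ℝ) / 2) := IsUnit.mk0 _ (by positivity)
  rw [funext (calibWeight_eq X), integrable_const_mul_iff hscale,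
    integrable_inv_quadForm_piGaussian_iff (isStarProjection_pureErrorProj X)
      (trace_pureErrorProj_pos hd) hm hv, trace_pureErrorProj, Nat.ofNat_lt_cast]

lemma lintegral_calibWeight_eq_top (hd : 0 < pureErrorDF X) (hd2 : pureErrorDF X ≤ 2)
    (hm : pureErrorProj X *ᵥ m = 0) (hv : 0 < v) :
    ∫⁻ y, ENNReal.ofReal (calibWeight X y) ∂(piGaussian m v) = ⊤ := by
  by_contra hne
  refine hd2.not_gt ((integrable_calibWeight_iff hd hm hv).1 ?_)
  exact (lintegral_ofReal_ne_top_iff_integrable (measurable_calibWeight X).aestronglyMeasurable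
    (.of_forall (calibWeight_nonneg X))).1 hne

lemma lintegral_calibWeight (hd : 2 < pureErrorDF X) (hm : pureErrorProj X *ᵥ m = 0)
    (hv : 0 < v) :
    ∫⁻ y, ENNReal.ofReal (calibWeight X y) ∂(piGaussian m v) =
      ENNReal.ofReal (pureErrorDF X / (2 * v * (pureErrorDF X - 2))) := by
  have hd' : 2 < (pureErrorProj X).trace := by
    rw [trace_pureErrorProj]
    exact_mod_cast hd
  rw [← ofReal_integral_eq_lintegral_ofReal ((integrable_calibWeight_iff (by omega) hm hv).2 hd)
    (.of_forall (calibWeight_nonneg X))]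
  simp only [calibWeight_eq]
  rw [integral_const_mul, integral_inv_quadForm_piGaussian (isStarProjection_pureErrorProj X) hd'
    hm hv, trace_pureErrorProj, div_mul_div_comm, mul_one, mul_assoc]

/- The calibration weight is a function of the pure error, which is independent of the projection
by `Q`. -/
lemma lintegral_calibWeight_mul_quadForm {Q : Matrix (Fin n) (Fin n) ℝ} (hQ : IsStarProjection Q)
    (hXQ : pureErrorProj X * Q = 0) (m c : Fin n → ℝ) (v : ℝ≥0) :
    ∫⁻ y, ENNReal.ofReal (calibWeight X y * quadForm Q (y - c)) ∂(piGaussian m v) =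
      (∫⁻ y, ENNReal.ofReal (calibWeight X y) ∂(piGaussian m v)) *
        ENNReal.ofReal (v * Q.trace + quadForm Q (m - c)) := by
  have hind := (indepFun_quadForm_piGaussian (isStarProjection_pureErrorProj X) hQ hXQ m c v).comp
    (φ := fun s => ENNReal.ofReal ((pureErrorDF X : ℝ) / 2 * s⁻¹)) (ψ := ENNReal.ofReal)
    (by fun_prop) (by fun_prop)
  simp only [Function.comp_def, ← calibWeight_eq] at hind
  have hmeas := measurable_calibWeight X
  rw [← lintegral_quadForm_piGaussian (posSemidef_of_isStarProjection hQ),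
    ← lintegral_mul_eq_lintegral_mul_lintegral_of_indepFun (by fun_prop) (by fun_prop) hind]
  simp only [Pi.mul_apply, ENNReal.ofReal_mul (calibWeight_nonneg X _)]

end CalibrationWeight

section Target

variable {𝕏 : Type*} {n p : ℕ}

lemma isTarget_iff_of_quadratic {D : Measure (Fin n → ℝ)} {w : (Fin n → ℝ) → ℝ}
    {loss : (Fin p → ℝ) → (Fin n → ℝ) → ℝ} {V : Matrix (Fin p) (Fin p) ℝ} (hV : V.PosDef)
    {A W : ℝ≥0∞} {c : ℝ} {t₀ : Fin p → ℝ} (hA : A ≠ ⊤) (hW : W ≠ ⊤) (hW₀ : W ≠ 0) (hc : 0 ≤ c)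
    (hloss : ∀ t, ∫⁻ y, ENNReal.ofReal (w y * loss t y) ∂D =
      A + W * ENNReal.ofReal (c + quadForm V (t - t₀))) (t : Fin p → ℝ) :
    IsTarget D w loss t ↔ t = t₀ := by
  have hzero : quadForm V 0 = 0 := zero_dotProduct _
  simp only [IsTarget, hloss]
  constructor
  · rintro ⟨-, hmin⟩
    by_contra hne
    have hle := hmin t₀
    rw [sub_self, hzero, add_zero, ENNReal.add_le_add_iff_left hA,
      ENNReal.mul_le_mul_iff_right hW₀ hW, ENNReal.ofReal_le_ofReal_iff hc] at hle
    linarith [quadForm_pos hV (sub_ne_zero.2 hne)]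
  · rintro rfl
    refine ⟨by finiteness, fun s => ?_⟩
    gcongr
    rw [sub_self, hzero]
    exact quadForm_nonneg hV.posSemidef _

/-- The vector of the mean responses at the treatments of the design. -/
def meanResponse (X : Fin n → 𝕏) (r : HyperVar 𝕏) : Fin n → ℝ := fun i => HyperVar.mean r (X i)

/-- The least squares fit to the mean responses, which is the target parameter value under both the
weighted and the unweighted loss. -/
def targetValue (f : 𝕏 → Fin p → ℝ) (X : Fin n → 𝕏) (r : HyperVar 𝕏) : Fin p → ℝ :=
  olsMatrix (modelMatrix f X) *ᵥ meanResponse X r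

variable (f : 𝕏 → Fin p → ℝ) (X : Fin n → 𝕏) (r : HyperVar 𝕏)

lemma targetValue_eq : targetValue f X r = ((modelMatrix f X)ᵀ * modelMatrix f X)⁻¹ *ᵥ
    ((modelMatrix f X)ᵀ *ᵥ fun i => HyperVar.mean r (X i)) := by
  rw [targetValue, olsMatrix, ← mulVec_mulVec]
  rfl

lemma designerDist_eq_piGaussian :
    designerDist X r = piGaussian (meanResponse X r) (HyperVar.kappa r) := rfl

lemma pureErrorProj_mulVec_meanResponse : pureErrorProj X *ᵥ meanResponse X r = 0 :=
  pureErrorProj_mulVec X _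

lemma lintegral_ssLoss_designerDist (t : Fin p → ℝ) :
    ∫⁻ y, ENNReal.ofReal (ssLoss f X t y) ∂(designerDist X r) =
      ENNReal.ofReal (HyperVar.kappa r * n + ssLoss f X t (meanResponse X r)) := by
  simp_rw [ssLoss_eq_quadForm_one]
  rw [designerDist_eq_piGaussian, lintegral_quadForm_piGaussian PosSemidef.one, trace_one,
    Fintype.card_fin]

variable {f X r}

lemma lintegral_calibWeight_mul_ssLoss_designerDist (hd : 0 < pureErrorDF X)
    (hr : 0 < HyperVar.kappa r) (t : Fin p → ℝ) :
    ∫⁻ y, ENNReal.ofReal (calibWeight X y * ssLoss f X t y) ∂(designerDist X r) =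
      ENNReal.ofReal (pureErrorDF X / 2) +
        (∫⁻ y, ENNReal.ofReal (calibWeight X y) ∂(designerDist X r)) *
          ENNReal.ofReal (HyperVar.kappa r * numTreatments X +
            ssLoss f X t (meanResponse X r)) := by
  have hμ := pureErrorProj_mulVec_meanResponse X r
  have hsplit : ∀ᵐ y ∂(designerDist X r), ENNReal.ofReal (calibWeight X y * ssLoss f X t y) =
      ENNReal.ofReal (pureErrorDF X / 2) + ENNReal.ofReal
        (calibWeight X y * quadForm (treatmentHat X) (y - modelMatrix f X *ᵥ t)) := by
    filter_upwards [ae_quadForm_pureErrorProj_pos hd hμ hr] with y hy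
    rw [ssLoss_eq_pureError_add_lackOfFit, mul_add,
      calibWeight_mul_quadForm_pureErrorProj hy.ne', ENNReal.ofReal_add (by positivity)]
    exact mul_nonneg (calibWeight_nonneg X y)
      (quadForm_nonneg (posSemidef_of_isStarProjection (isStarProjection_treatmentHat X)) _)
  have hmean : ssLoss f X t (meanResponse X r) =
      quadForm (treatmentHat X) (meanResponse X r - modelMatrix f X *ᵥ t) := by
    rw [ssLoss_eq_pureError_add_lackOfFit, quadForm, hμ, dotProduct_zero, zero_add]
  rw [lintegral_congr_ae hsplit, lintegral_add_left measurable_const, designerDist_eq_piGaussian,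
    lintegral_const, measure_univ, mul_one, hmean, ← trace_treatmentHat]
  exact congrArg _ (lintegral_calibWeight_mul_quadForm (isStarProjection_treatmentHat X)
    (pureErrorProj_mul_treatmentHat X) _ _ _)

lemma isTarget_unweighted_iff (hF : ((modelMatrix f X)ᵀ * modelMatrix f X).det ≠ 0)
    (t : Fin p → ℝ) :
    IsTarget (designerDist X r) (fun _ => 1) (ssLoss f X) t ↔ t = targetValue f X r := by
  refine isTarget_iff_of_quadratic (posDef_transpose_mul_self hF) (A := 0) (W := 1)
    (c := HyperVar.kappa r * n + ssLoss f X (targetValue f X r) (meanResponse X r))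
    ENNReal.zero_ne_top ENNReal.one_ne_top one_ne_zero
    (add_nonneg (by positivity) (ssLoss_nonneg ..)) (fun s => ?_) t
  simp only [one_mul]
  rw [lintegral_ssLoss_designerDist, ssLoss_eq_ssLoss_olsMatrix_add hF, zero_add, add_assoc,
    targetValue]

lemma isTarget_weighted_iff (hF : ((modelMatrix f X)ᵀ * modelMatrix f X).det ≠ 0)
    (hd : 2 < pureErrorDF X) (hr : 0 < HyperVar.kappa r) (t : Fin p → ℝ) :
    IsTarget (designerDist X r) (calibWeight X) (ssLoss f X) t ↔ t = targetValue f X r := by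
  have hW := lintegral_calibWeight hd (pureErrorProj_mulVec_meanResponse X r) hr
  have hd' : (0 : ℝ) < pureErrorDF X - 2 := sub_pos.2 (by exact_mod_cast hd)
  refine isTarget_iff_of_quadratic (posDef_transpose_mul_self hF)
    (A := ENNReal.ofReal (pureErrorDF X / 2))
    (W := ∫⁻ y, ENNReal.ofReal (calibWeight X y) ∂(designerDist X r))
    (c := HyperVar.kappa r * numTreatments X + ssLoss f X (targetValue f X r) (meanResponse X r))
    ENNReal.ofReal_ne_top (hW ▸ ENNReal.ofReal_ne_top) ?_
    (add_nonneg (by positivity) (ssLoss_nonneg ..)) (fun s => ?_) t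
  · rw [designerDist_eq_piGaussian, hW, ENNReal.ofReal_ne_zero_iff]
    positivity
  · rw [lintegral_calibWeight_mul_ssLoss_designerDist (by omega) hr,
      ssLoss_eq_ssLoss_olsMatrix_add hF, add_assoc, targetValue]

lemma not_isTarget_weighted (hn : 0 < n) (hd : 0 < pureErrorDF X) (hd2 : pureErrorDF X ≤ 2)
    (hr : 0 < HyperVar.kappa r) (t : Fin p → ℝ) :
    ¬ IsTarget (designerDist X r) (calibWeight X) (ssLoss f X) t := by
  refine fun h => h.1 ?_
  have hq := numTreatments_pos X hn
  rw [lintegral_calibWeight_mul_ssLoss_designerDist hd hr, designerDist_eq_piGaussian,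
    lintegral_calibWeight_eq_top hd hd2 (pureErrorProj_mulVec_meanResponse X r) hr,
    ENNReal.top_mul, add_top]
  rw [ENNReal.ofReal_ne_zero_iff]
  exact add_pos_of_pos_of_nonneg (by positivity) (ssLoss_nonneg ..)

lemma eq_targetValue_of_isTarget (hp : 0 < p)
    (hF : ((modelMatrix f X)ᵀ * modelMatrix f X).det ≠ 0) (hd : 0 < pureErrorDF X)
    (hr : 0 < HyperVar.kappa r) {t : Fin p → ℝ}
    (ht : IsTarget (designerDist X r) (calibWeight X) (ssLoss f X) t ∨
      IsTarget (designerDist X r) (fun _ => 1) (ssLoss f X) t) : t = targetValue f X r := by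
  rcases ht with ht | ht
  · rcases le_or_gt (pureErrorDF X) 2 with hd2 | hd2
    · have hn := pos_of_det_modelMatrix_transpose_mul_self_ne_zero hp hF
      exact absurd ht (not_isTarget_weighted hn hd hd2 hr t)
    · exact (isTarget_weighted_iff hF hd2 hr t).1 ht
  · exact (isTarget_unweighted_iff hF t).1 ht

end Target

section Expectation

variable {Ω : Type*} [MeasurableSpace Ω] {P : Measure Ω} {g : Ω → EReal}

lemma HasExpectation.congr_ae {g' : Ω → EReal} {a : EReal} (h : HasExpectation P g a)
    (hg : g =ᵐ[P] g') : HasExpectation P g' a := by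
  obtain ⟨hmeas, hfin, heq⟩ := h
  have hpos : ∫⁻ x, (g x).toENNReal ∂P = ∫⁻ x, (g' x).toENNReal ∂P :=
    lintegral_congr_ae (hg.fun_comp EReal.toENNReal)
  have hneg : ∫⁻ x, (-g x).toENNReal ∂P = ∫⁻ x, (-g' x).toENNReal ∂P :=
    lintegral_congr_ae (hg.fun_comp fun z => (-z).toENNReal)
  rw [hpos, hneg] at hfin heq
  exact ⟨hmeas.congr hg, hfin, heq⟩

lemma neg_coe_toENNReal (x : ℝ) : (-(x : EReal)).toENNReal = ENNReal.ofReal (-x) := by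
  rw [← EReal.coe_neg, EReal.real_coe_toENNReal]

lemma hasExpectation_coe {f : Ω → ℝ} (hf : Integrable f P) :
    HasExpectation P (fun x => (f x : EReal)) ((∫ x, f x ∂P : ℝ) : EReal) := by
  have hpos : ∫⁻ x, ENNReal.ofReal (f x) ∂P ≠ ⊤ := hf.lintegral_lt_top.ne
  have hneg : ∫⁻ x, ENNReal.ofReal (-f x) ∂P ≠ ⊤ := hf.neg.lintegral_lt_top.ne
  refine ⟨measurable_coe_real_ereal.comp_aemeasurable hf.aemeasurable, ?_, ?_⟩
  · simp only [EReal.real_coe_toENNReal]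
    exact Or.inl hpos
  · simp only [EReal.real_coe_toENNReal, neg_coe_toENNReal]
    rw [integral_eq_lintegral_pos_part_sub_lintegral_neg_part hf, EReal.coe_sub,
      EReal.coe_ennreal_toReal hpos, EReal.coe_ennreal_toReal hneg]

lemma hasExpectation_coe_sub_eq_bot {f b : Ω → ℝ} (hf : Integrable f P) (hb : AEMeasurable b P)
    (hb_nonneg : ∀ x, 0 ≤ b x) (hb_top : ∫⁻ x, ENNReal.ofReal (b x) ∂P = ⊤) :
    HasExpectation P (fun x => ((f x - b x : ℝ) : EReal)) ⊥ := by
  have hf_fin : ∫⁻ x, ENNReal.ofReal (f x) ∂P ≠ ⊤ := hf.lintegral_lt_top.ne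
  have hpos : ∫⁻ x, ENNReal.ofReal (f x - b x) ∂P ≠ ⊤ :=
    ne_top_of_le_ne_top hf_fin (lintegral_mono fun x =>
      ENNReal.ofReal_le_ofReal (sub_le_self _ (hb_nonneg x)))
  have hneg : ∫⁻ x, ENNReal.ofReal (-(f x - b x)) ∂P = ⊤ := by
    have hle : ∫⁻ x, ENNReal.ofReal (b x) ∂P ≤
        ∫⁻ x, ENNReal.ofReal (-(f x - b x)) ∂P + ∫⁻ x, ENNReal.ofReal (f x) ∂P := by
      rw [← lintegral_add_right' _ hf.aemeasurable.ennreal_ofReal]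
      refine lintegral_mono fun x => ?_
      calc ENNReal.ofReal (b x) = ENNReal.ofReal (-(f x - b x) + f x) := by ring_nf
        _ ≤ _ := ENNReal.ofReal_add_le
    rw [hb_top, top_le_iff, ENNReal.add_eq_top] at hle
    exact hle.resolve_right hf_fin
  refine ⟨measurable_coe_real_ereal.comp_aemeasurable (hf.aemeasurable.sub hb), ?_, ?_⟩
  · simp only [EReal.real_coe_toENNReal]
    exact Or.inl hpos
  · simp only [EReal.real_coe_toENNReal, neg_coe_toENNReal]
    rw [hneg, ← EReal.coe_ennreal_toReal hpos]
    rfl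

variable [IsProbabilityMeasure P]

lemma hasExpectation_const (a : EReal) : HasExpectation P (fun _ => a) a := by
  induction a with
  | bot => exact ⟨aemeasurable_const, by simp, by simp⟩
  | coe a => simpa using hasExpectation_coe (integrable_const (μ := P) a)
  | top => exact ⟨aemeasurable_const, by simp, by simp⟩

lemma integral_pos_of_ae_pos {f : Ω → ℝ} (hf : Integrable f P) (hf_pos : ∀ᵐ x ∂P, 0 < f x) :
    0 < ∫ x, f x ∂P := by
  obtain ⟨x, hle, hpos⟩ :=
    ((frequently_ae_iff.2 (measure_le_integral_pos hf).ne').and_eventually hf_pos).exists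
  exact hpos.trans_le hle

lemma hasExpectation_coe_mul_const {f : Ω → ℝ} (hf : Integrable f P) (hf_pos : ∀ᵐ x ∂P, 0 < f x)
    (a : EReal) :
    HasExpectation P (fun x => (f x : EReal) * a) (((∫ x, f x ∂P : ℝ) : EReal) * a) := by
  have hpos := integral_pos_of_ae_pos hf hf_pos
  induction a with
  | bot =>
    rw [EReal.coe_mul_bot_of_pos hpos]
    exact (hasExpectation_const ⊥).congr_ae
      (hf_pos.mono fun _ hx => (EReal.coe_mul_bot_of_pos hx).symm)
  | coe a =>
    simp only [← EReal.coe_mul, ← integral_mul_const]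
    exact hasExpectation_coe (hf.mul_const a)
  | top =>
    rw [EReal.coe_mul_top_of_pos hpos]
    exact (hasExpectation_const ⊤).congr_ae
      (hf_pos.mono fun _ hx => (EReal.coe_mul_top_of_pos hx).symm)

lemma hasExpectation_coe_add_const {f : Ω → ℝ} (hf : Integrable f P) (a : EReal) :
    HasExpectation P (fun x => (f x : EReal) + a) (((∫ x, f x ∂P : ℝ) : EReal) + a) := by
  induction a with
  | bot => simpa only [EReal.add_bot] using hasExpectation_const ⊥
  | coe a =>
    have h := hasExpectation_coe (hf.add (integrable_const a))
    simpa [integral_add hf (integrable_const a)] using h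
  | top => simpa only [EReal.coe_add_top] using hasExpectation_const ⊤

end Expectation

section Utility

variable {𝕏 : Type*} {n p : ℕ} {f : 𝕏 → Fin p → ℝ} {X : Fin n → 𝕏} {r : HyperVar 𝕏}

lemma not_gibbsPosteriorExists_calibWeight (hd : pureErrorDF X = 0) (y : Fin n → ℝ)
    (loss prior : (Fin p → ℝ) → ℝ) : ¬ GibbsPosteriorExists (calibWeight X y) loss prior :=
  fun h => h.1.ne' (calibWeight_eq_zero hd y)

lemma utilityNSE_ssLoss (hF : ((modelMatrix f X)ᵀ * modelMatrix f X).det ≠ 0) {y : Fin n → ℝ}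
    (hw : 0 < calibWeight X y) (t : Fin p → ℝ) :
    utilityNSE (calibWeight X y) (fun s => ssLoss f X s y) (fun _ => 1) t =
      ((-quadForm 1 (t - olsMatrix (modelMatrix f X) *ᵥ y) : ℝ) : EReal) := by
  have hV := posDef_transpose_mul_self hF
  have hloss := fun s => ssLoss_eq_ssLoss_olsMatrix_add hF s y
  rw [utilityNSE, if_pos ((gibbsPosteriorExists_quadratic_iff hV hloss).2 hw),
    gibbsMean_quadratic hV hloss hw]

lemma log_pi_div_calibWeight (hd : 0 < pureErrorDF X) {y : Fin n → ℝ}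
    (hy : 0 < quadForm (pureErrorProj X) y) :
    Real.log (Real.pi / calibWeight X y) = Real.log (2 * Real.pi) - Real.log (pureErrorDF X) +
      Real.log (quadForm (pureErrorProj X) y) := by
  have : (0 : ℝ) < pureErrorDF X := by exact_mod_cast hd
  rw [← Real.log_div (by positivity) (by positivity), ← Real.log_mul (by positivity) hy.ne',
    calibWeight_eq]
  congr 1
  field_simp

lemma utilitySH_ssLoss (hF : ((modelMatrix f X)ᵀ * modelMatrix f X).det ≠ 0)
    (hd : 0 < pureErrorDF X) {y : Fin n → ℝ} (hy : 0 < quadForm (pureErrorProj X) y)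
    (t : Fin p → ℝ) :
    utilitySH (calibWeight X y) (fun s => ssLoss f X s y) (fun _ => 1) t =
      ((1 / 2 * Real.log ((modelMatrix f X)ᵀ * modelMatrix f X).det -
        p / 2 * (Real.log (2 * Real.pi) - Real.log (pureErrorDF X) +
          Real.log (quadForm (pureErrorProj X) y)) -
        calibWeight X y * quadForm ((modelMatrix f X)ᵀ * modelMatrix f X)
          (t - olsMatrix (modelMatrix f X) *ᵥ y) : ℝ) : EReal) := by
  have hV := posDef_transpose_mul_self hF
  have hloss := fun s => ssLoss_eq_ssLoss_olsMatrix_add hF s y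
  have hw := calibWeight_pos hd hy
  rw [utilitySH, if_pos ((gibbsPosteriorExists_quadratic_iff hV hloss).2 hw),
    log_gibbsPdf_quadratic hV hloss hw, log_pi_div_calibWeight hd hy]

lemma targetValue_sub_olsMatrix_mulVec (y : Fin n → ℝ) :
    targetValue f X r - olsMatrix (modelMatrix f X) *ᵥ y =
      olsMatrix (modelMatrix f X) *ᵥ (meanResponse X r - y) := by
  rw [targetValue, mulVec_sub]

lemma quadForm_one_targetValue_sub (y : Fin n → ℝ) :
    quadForm 1 (targetValue f X r - olsMatrix (modelMatrix f X) *ᵥ y) =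
      quadForm ((olsMatrix (modelMatrix f X))ᵀ * olsMatrix (modelMatrix f X))
        (y - meanResponse X r) := by
  rw [targetValue_sub_olsMatrix_mulVec, quadForm_sub_comm, quadForm_transpose_mul_self, quadForm,
    one_mulVec]

lemma quadForm_transpose_mul_self_targetValue_sub
    (hF : ((modelMatrix f X)ᵀ * modelMatrix f X).det ≠ 0)
    (y : Fin n → ℝ) :
    quadForm ((modelMatrix f X)ᵀ * modelMatrix f X)
        (targetValue f X r - olsMatrix (modelMatrix f X) *ᵥ y) =
      quadForm (hatMatrix (modelMatrix f X)) (y - meanResponse X r) := by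
  rw [targetValue_sub_olsMatrix_mulVec, quadForm_sub_comm, quadForm_transpose_mul_self,
    quadForm_hatMatrix hF]

lemma objectiveNSE_of_pos (hd : 0 < pureErrorDF X) :
    objectiveNSE f X =
      ((-(((modelMatrix f X)ᵀ * modelMatrix f X)⁻¹).trace : ℝ) : EReal) := by
  rw [objectiveNSE, h₁, if_neg hd.ne', mul_one, EReal.coe_neg]

lemma objectiveNSE_eq_bot (hp : 0 < p) (hF : ((modelMatrix f X)ᵀ * modelMatrix f X).det ≠ 0)
    (hd : pureErrorDF X = 0) : objectiveNSE f X = ⊥ := by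
  have : Nonempty (Fin p) := ⟨⟨0, hp⟩⟩
  have htrace := (posDef_transpose_mul_self hF).inv.trace_pos
  rw [objectiveNSE, h₁, if_pos hd, ← EReal.coe_neg,
    EReal.coe_mul_top_of_neg (neg_lt_zero.2 htrace)]

lemma objectiveSH_eq_bot (hp : 0 < p) (hd : pureErrorDF X ≤ 2) : objectiveSH f X = ⊥ := by
  have hp' : -(p : ℝ) < 0 := neg_lt_zero.2 (by exact_mod_cast hp)
  rw [objectiveSH, h₂, if_pos hd, ← EReal.coe_neg, EReal.coe_mul_top_of_neg hp', EReal.bot_add]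

lemma objectiveSH_of_two_lt (hd : 2 < pureErrorDF X) :
    objectiveSH f X =
      ((-(p : ℝ) * ((Complex.digamma ((pureErrorDF X : ℂ) / 2)).re - Real.log (pureErrorDF X) +
          (pureErrorDF X : ℝ) / ((pureErrorDF X : ℝ) - 2)) +
        Real.log ((modelMatrix f X)ᵀ * modelMatrix f X).det : ℝ) : EReal) := by
  rw [objectiveSH, h₂, if_neg hd.not_ge, ← EReal.coe_neg, ← EReal.coe_mul, ← EReal.coe_add]

end Utility

section ConditionalExpectation

variable {𝕏 : Type*} {n p : ℕ} {f : 𝕏 → Fin p → ℝ} {X : Fin n → 𝕏} {r : HyperVar 𝕏}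

instance isProbabilityMeasure_designerDist : IsProbabilityMeasure (designerDist X r) := by
  unfold designerDist
  infer_instance

lemma ae_designerDist_quadForm_pureErrorProj_pos (hd : 0 < pureErrorDF X)
    (hr : 0 < HyperVar.kappa r) : ∀ᵐ y ∂(designerDist X r), 0 < quadForm (pureErrorProj X) y :=
  ae_quadForm_pureErrorProj_pos hd (pureErrorProj_mulVec_meanResponse X r) hr

lemma hasExpectation_utilityNSE_targetValue
    (hF : ((modelMatrix f X)ᵀ * modelMatrix f X).det ≠ 0) (hd : 0 < pureErrorDF X)
    (hr : 0 < HyperVar.kappa r) :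
    HasExpectation (designerDist X r)
      (fun y => utilityNSE (calibWeight X y) (fun s => ssLoss f X s y) (fun _ => 1)
        (targetValue f X r))
      ((HyperVar.kappa r * -(((modelMatrix f X)ᵀ * modelMatrix f X)⁻¹).trace : ℝ) : EReal) := by
  set L := olsMatrix (modelMatrix f X) with hL
  have hmean : ∫ y, -quadForm (Lᵀ * L) (y - meanResponse X r) ∂(designerDist X r) =
      HyperVar.kappa r * -(((modelMatrix f X)ᵀ * modelMatrix f X)⁻¹).trace := by
    rw [integral_neg, designerDist_eq_piGaussian, integral_quadForm_piGaussian, sub_self, quadForm,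
      zero_dotProduct, add_zero, trace_mul_comm, hL, olsMatrix_mul_transpose_self hF, mul_neg]
  rw [← hmean]
  refine (hasExpectation_coe (integrable_quadForm_piGaussian ..).neg).congr_ae ?_
  filter_upwards [ae_designerDist_quadForm_pureErrorProj_pos hd hr] with y hy
  rw [utilityNSE_ssLoss hF (calibWeight_pos hd hy), quadForm_one_targetValue_sub, Pi.neg_apply]

lemma hasExpectation_utilityNSE (hp : 0 < p)
    (hF : ((modelMatrix f X)ᵀ * modelMatrix f X).det ≠ 0) (hr : 0 < HyperVar.kappa r)
    {t : Fin p → ℝ} (ht : 0 < pureErrorDF X → t = targetValue f X r) :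
    HasExpectation (designerDist X r)
      (fun y => utilityNSE (calibWeight X y) (fun s => ssLoss f X s y) (fun _ => 1) t)
      (((HyperVar.kappa r : ℝ) : EReal) * objectiveNSE f X) := by
  rcases Nat.eq_zero_or_pos (pureErrorDF X) with hd | hd
  · rw [objectiveNSE_eq_bot hp hF hd, EReal.coe_mul_bot_of_pos (NNReal.coe_pos.2 hr)]
    simp only [utilityNSE, if_neg (not_gibbsPosteriorExists_calibWeight hd _ _ _)]
    exact hasExpectation_const ⊥
  · rw [ht hd, objectiveNSE_of_pos hd, ← EReal.coe_mul]
    exact hasExpectation_utilityNSE_targetValue hF hd hr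

lemma integrable_const_sub_mul_log_pureError (hd : 0 < pureErrorDF X)
    (hr : 0 < HyperVar.kappa r) (a b c : ℝ) :
    Integrable (fun y => a - b * (c + Real.log (quadForm (pureErrorProj X) y)))
      (designerDist X r) :=
  (integrable_const a).sub (((integrable_const c).add
    (integrable_log_quadForm_piGaussian (isStarProjection_pureErrorProj X)
      (trace_pureErrorProj_pos hd) (pureErrorProj_mulVec_meanResponse X r) hr)).const_mul b)

lemma integral_const_sub_mul_log_pureError (hd : 0 < pureErrorDF X)
    (hr : 0 < HyperVar.kappa r) (a b c : ℝ) :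
    ∫ y, (a - b * (c + Real.log (quadForm (pureErrorProj X) y))) ∂(designerDist X r) =
      a - b * (c + ((Complex.digamma (pureErrorDF X / 2)).re + Real.log 2 +
        Real.log (HyperVar.kappa r))) := by
  have hP := isStarProjection_pureErrorProj X
  have htr := trace_pureErrorProj_pos hd
  have hμ := pureErrorProj_mulVec_meanResponse X r
  have hlog := integrable_log_quadForm_piGaussian hP htr hμ hr
  rw [designerDist_eq_piGaussian, integral_sub (by fun_prop) (by fun_prop), integral_const_mul,
    integral_add (by fun_prop) hlog, integral_log_quadForm_piGaussian hP htr hμ hr,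
    trace_pureErrorProj]
  simp

lemma measurable_calibWeight_mul_quadForm_hatMatrix :
    Measurable fun y => calibWeight X y *
      quadForm (hatMatrix (modelMatrix f X)) (y - meanResponse X r) :=
  (measurable_calibWeight X).mul (by fun_prop)

lemma calibWeight_mul_quadForm_hatMatrix_nonneg
    (hF : ((modelMatrix f X)ᵀ * modelMatrix f X).det ≠ 0) (y : Fin n → ℝ) :
    0 ≤ calibWeight X y * quadForm (hatMatrix (modelMatrix f X)) (y - meanResponse X r) :=
  mul_nonneg (calibWeight_nonneg X y)
    (quadForm_nonneg (posSemidef_of_isStarProjection (isStarProjection_hatMatrix hF)) _)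

lemma lintegral_calibWeight_mul_quadForm_hatMatrix
    (hF : ((modelMatrix f X)ᵀ * modelMatrix f X).det ≠ 0) :
    ∫⁻ y, ENNReal.ofReal (calibWeight X y *
        quadForm (hatMatrix (modelMatrix f X)) (y - meanResponse X r)) ∂(designerDist X r) =
      (∫⁻ y, ENNReal.ofReal (calibWeight X y) ∂(designerDist X r)) *
        ENNReal.ofReal (HyperVar.kappa r * p) := by
  rw [designerDist_eq_piGaussian, lintegral_calibWeight_mul_quadForm
    (isStarProjection_hatMatrix hF) (pureErrorProj_mul_hatMatrix_modelMatrix X f),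
    trace_hatMatrix hF, sub_self, quadForm, zero_dotProduct, add_zero, Fintype.card_fin]

lemma integrable_calibWeight_mul_quadForm_hatMatrix
    (hF : ((modelMatrix f X)ᵀ * modelMatrix f X).det ≠ 0) (hd : 2 < pureErrorDF X)
    (hr : 0 < HyperVar.kappa r) :
    Integrable (fun y => calibWeight X y *
      quadForm (hatMatrix (modelMatrix f X)) (y - meanResponse X r)) (designerDist X r) := by
  refine (lintegral_ofReal_ne_top_iff_integrable
    measurable_calibWeight_mul_quadForm_hatMatrix.aestronglyMeasurable
    (.of_forall (calibWeight_mul_quadForm_hatMatrix_nonneg hF))).1 ?_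
  rw [lintegral_calibWeight_mul_quadForm_hatMatrix hF, designerDist_eq_piGaussian,
    lintegral_calibWeight hd (pureErrorProj_mulVec_meanResponse X r) hr]
  finiteness

lemma integral_calibWeight_mul_quadForm_hatMatrix
    (hF : ((modelMatrix f X)ᵀ * modelMatrix f X).det ≠ 0) (hd : 2 < pureErrorDF X)
    (hr : 0 < HyperVar.kappa r) :
    ∫ y, calibWeight X y * quadForm (hatMatrix (modelMatrix f X)) (y - meanResponse X r)
        ∂(designerDist X r) = p / 2 * (pureErrorDF X / (pureErrorDF X - 2)) := by
  have hd' : (0 : ℝ) < pureErrorDF X - 2 := sub_pos.2 (by exact_mod_cast hd)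
  have : (0 : ℝ) < HyperVar.kappa r := hr
  rw [integral_eq_lintegral_of_nonneg_ae
      (.of_forall (calibWeight_mul_quadForm_hatMatrix_nonneg hF))
      measurable_calibWeight_mul_quadForm_hatMatrix.aestronglyMeasurable,
    lintegral_calibWeight_mul_quadForm_hatMatrix hF, designerDist_eq_piGaussian,
    lintegral_calibWeight hd (pureErrorProj_mulVec_meanResponse X r) hr, ENNReal.toReal_mul,
    ENNReal.toReal_ofReal (by positivity), ENNReal.toReal_ofReal (by positivity)]
  field_simp

lemma ae_eq_utilitySH_targetValue (hF : ((modelMatrix f X)ᵀ * modelMatrix f X).det ≠ 0)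
    (hd : 0 < pureErrorDF X) (hr : 0 < HyperVar.kappa r) :
    (fun y => ((1 / 2 * Real.log ((modelMatrix f X)ᵀ * modelMatrix f X).det -
      p / 2 * (Real.log (2 * Real.pi) - Real.log (pureErrorDF X) +
        Real.log (quadForm (pureErrorProj X) y)) -
      calibWeight X y * quadForm (hatMatrix (modelMatrix f X)) (y - meanResponse X r) : ℝ) :
        EReal)) =ᵐ[designerDist X r]
      fun y => utilitySH (calibWeight X y) (fun s => ssLoss f X s y) (fun _ => 1)
        (targetValue f X r) := by
  filter_upwards [ae_designerDist_quadForm_pureErrorProj_pos hd hr] with y hy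
  rw [utilitySH_ssLoss hF hd hy, quadForm_transpose_mul_self_targetValue_sub hF]

lemma hasExpectation_utilitySH_targetValue
    (hF : ((modelMatrix f X)ᵀ * modelMatrix f X).det ≠ 0) (hd : 2 < pureErrorDF X)
    (hr : 0 < HyperVar.kappa r) :
    HasExpectation (designerDist X r)
      (fun y => utilitySH (calibWeight X y) (fun s => ssLoss f X s y) (fun _ => 1)
        (targetValue f X r))
      ((1 / 2 * Real.log ((modelMatrix f X)ᵀ * modelMatrix f X).det -
        p / 2 * (Real.log (2 * Real.pi) - Real.log (pureErrorDF X) +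
          ((Complex.digamma (pureErrorDF X / 2)).re + Real.log 2 +
            Real.log (HyperVar.kappa r))) -
        p / 2 * (pureErrorDF X / (pureErrorDF X - 2)) : ℝ) : EReal) := by
  have hd₀ : 0 < pureErrorDF X := by omega
  have hlog := integrable_const_sub_mul_log_pureError (X := X) hd₀ hr
  have hdev := integrable_calibWeight_mul_quadForm_hatMatrix hF hd hr
  rw [← integral_calibWeight_mul_quadForm_hatMatrix hF hd hr,
    ← integral_const_sub_mul_log_pureError hd₀ hr, ← integral_sub (hlog ..) hdev]
  exact (hasExpectation_coe ((hlog ..).sub hdev)).congr_ae (ae_eq_utilitySH_targetValue hF hd₀ hr)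

lemma hasExpectation_utilitySH_targetValue_eq_bot (hp : 0 < p)
    (hF : ((modelMatrix f X)ᵀ * modelMatrix f X).det ≠ 0) (hd : 0 < pureErrorDF X)
    (hd2 : pureErrorDF X ≤ 2) (hr : 0 < HyperVar.kappa r) :
    HasExpectation (designerDist X r)
      (fun y => utilitySH (calibWeight X y) (fun s => ssLoss f X s y) (fun _ => 1)
        (targetValue f X r)) ⊥ := by
  have hdev : ∫⁻ y, ENNReal.ofReal (calibWeight X y *
      quadForm (hatMatrix (modelMatrix f X)) (y - meanResponse X r)) ∂(designerDist X r) = ⊤ := by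
    have hκp : (0 : ℝ) < HyperVar.kappa r * p := mul_pos hr (by exact_mod_cast hp)
    rw [lintegral_calibWeight_mul_quadForm_hatMatrix hF, designerDist_eq_piGaussian,
      lintegral_calibWeight_eq_top hd hd2 (pureErrorProj_mulVec_meanResponse X r) hr,
      ENNReal.top_mul (ENNReal.ofReal_pos.2 hκp).ne']
  refine HasExpectation.congr_ae ?_ (ae_eq_utilitySH_targetValue hF hd hr)
  exact hasExpectation_coe_sub_eq_bot (integrable_const_sub_mul_log_pureError hd hr ..)
    measurable_calibWeight_mul_quadForm_hatMatrix.aemeasurable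
    (calibWeight_mul_quadForm_hatMatrix_nonneg hF) hdev

lemma hasExpectation_utilitySH (hp : 0 < p)
    (hF : ((modelMatrix f X)ᵀ * modelMatrix f X).det ≠ 0) (hr : 0 < HyperVar.kappa r)
    {t : Fin p → ℝ} (ht : 0 < pureErrorDF X → t = targetValue f X r) :
    HasExpectation (designerDist X r)
      (fun y => utilitySH (calibWeight X y) (fun s => ssLoss f X s y) (fun _ => 1) t)
      (((-((p : ℝ) / 2) * (Real.log (2 * Real.pi) + Real.log (HyperVar.kappa r) + Real.log 2) :
          ℝ) : EReal) + ((1 / 2 : ℝ) : EReal) * objectiveSH f X) := by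
  rcases le_or_gt (pureErrorDF X) 2 with hd2 | hd2
  · rw [objectiveSH_eq_bot hp hd2, EReal.coe_mul_bot_of_pos one_half_pos, EReal.add_bot]
    rcases Nat.eq_zero_or_pos (pureErrorDF X) with hd | hd
    · simp only [utilitySH, if_neg (not_gibbsPosteriorExists_calibWeight hd _ _ _)]
      exact hasExpectation_const ⊥
    · rw [ht hd]
      exact hasExpectation_utilitySH_targetValue_eq_bot hp hF hd hd2 hr
  · rw [ht (by omega), objectiveSH_of_two_lt hd2, ← EReal.coe_mul, ← EReal.coe_add]
    convert hasExpectation_utilitySH_targetValue hF hd2 hr using 2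
    ring

end ConditionalExpectation

section ExpectedUtility

variable {𝕏 : Type*} {n p : ℕ} {X : Fin n → 𝕏} {f : 𝕏 → Fin p → ℝ} {C : Measure (HyperVar 𝕏)}
  [IsProbabilityMeasure C] {θ : HyperVar 𝕏 → Fin p → ℝ}

lemma isGibbsExpectedNSE (hp : 0 < p) (hκ_pos : ∀ᵐ r ∂C, 0 < HyperVar.kappa r)
    (hκ_int : Integrable (fun r => (HyperVar.kappa r : ℝ)) C)
    (hF : ((modelMatrix f X)ᵀ * modelMatrix f X).det ≠ 0)
    (hθ : 0 < pureErrorDF X → ∀ᵐ r ∂C, θ r = targetValue f X r) :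
    IsGibbsExpectedNSE f C X θ
      (((∫ r, (HyperVar.kappa r : ℝ) ∂C : ℝ) : EReal) * objectiveNSE f X) := by
  refine ⟨_, ?_, hasExpectation_coe_mul_const hκ_int (hκ_pos.mono fun _ => NNReal.coe_pos.2) _⟩
  filter_upwards [hκ_pos, Filter.eventually_imp_distrib_left.2 hθ] with r hr hθr
  exact hasExpectation_utilityNSE hp hF hr hθr

lemma isGibbsExpectedSH (hp : 0 < p) (hκ_pos : ∀ᵐ r ∂C, 0 < HyperVar.kappa r)
    (hlog : Integrable (fun r => Real.log (HyperVar.kappa r : ℝ)) C)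
    (hF : ((modelMatrix f X)ᵀ * modelMatrix f X).det ≠ 0)
    (hθ : 0 < pureErrorDF X → ∀ᵐ r ∂C, θ r = targetValue f X r) :
    IsGibbsExpectedSH f C X θ
      (((-((p : ℝ) / 2) * (Real.log (2 * Real.pi) +
          (∫ r, Real.log (HyperVar.kappa r : ℝ) ∂C) + Real.log 2) : ℝ) : EReal) +
        ((1 / 2 : ℝ) : EReal) * objectiveSH f X) := by
  have hconst : -((p : ℝ) / 2) * (Real.log (2 * Real.pi) +
      (∫ r, Real.log (HyperVar.kappa r : ℝ) ∂C) + Real.log 2) =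
      ∫ r, -((p : ℝ) / 2) * (Real.log (2 * Real.pi) + Real.log (HyperVar.kappa r : ℝ) +
        Real.log 2) ∂C := by
    rw [integral_const_mul, integral_add (by fun_prop) (by fun_prop),
      integral_add (by fun_prop) hlog]
    simp
  rw [hconst]
  refine ⟨_, ?_, hasExpectation_coe_add_const (by fun_prop) _⟩
  filter_upwards [hκ_pos, Filter.eventually_imp_distrib_left.2 hθ] with r hr hθr
  exact hasExpectation_utilitySH hp hF hr hθr

end ExpectedUtility

end

end GibbsDesign

open GibbsDesign in
theorem mainTheorem1 {𝕏 : Type*} {p : ℕ} (hp : 0 < p) (f : 𝕏 → Fin p → ℝ)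
    -- the hyper-variable distribution; the last hypothesis holds if `E_C(κ | σ²) = σ²`, and in
    -- particular if `σ²` is a constant and `E_C(κ) = σ²`
    (C : Measure (HyperVar 𝕏)) [IsProbabilityMeasure C]
    (hκ_pos : ∀ᵐ r ∂C, 0 < HyperVar.kappa r)
    (hκ_int : Integrable (fun r => (HyperVar.kappa r : ℝ)) C)
    (hσ_int : Integrable (fun r => (HyperVar.sigmaSq r : ℝ)) C)
    (hκσ : ∫ r, (HyperVar.kappa r : ℝ) ∂C = ∫ r, (HyperVar.sigmaSq r : ℝ) ∂C) :
    0 < ∫ r, (HyperVar.sigmaSq r : ℝ) ∂C ∧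
    ∀ (n : ℕ) (X : Fin n → 𝕏), ((modelMatrix f X)ᵀ * modelMatrix f X).det ≠ 0 →
      -- the target parameter values
      (∀ r : HyperVar 𝕏, 0 < HyperVar.kappa r → ∀ t : Fin p → ℝ,
        (2 < pureErrorDF X →
          (IsTarget (designerDist X r) (calibWeight X) (ssLoss f X) t ↔
            t = ((modelMatrix f X)ᵀ * modelMatrix f X)⁻¹ *ᵥ
              ((modelMatrix f X)ᵀ *ᵥ fun i => HyperVar.mean r (X i)))) ∧
        (IsTarget (designerDist X r) (fun _ => 1) (ssLoss f X) t ↔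
            t = ((modelMatrix f X)ᵀ * modelMatrix f X)⁻¹ *ᵥ
              ((modelMatrix f X)ᵀ *ᵥ fun i => HyperVar.mean r (X i)))) ∧
      -- the Gibbs expected utilities at the target parameter values
      ∀ θ : HyperVar 𝕏 → Fin p → ℝ,
        ((∀ᵐ r ∂C, IsTarget (designerDist X r) (calibWeight X) (ssLoss f X) (θ r)) ∨
          (∀ᵐ r ∂C, IsTarget (designerDist X r) (fun _ => 1) (ssLoss f X) (θ r))) →
        IsGibbsExpectedNSE f C X θ
          (((∫ r, (HyperVar.sigmaSq r : ℝ) ∂C : ℝ) : EReal) * objectiveNSE f X) ∧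
        (Integrable (fun r => Real.log (HyperVar.kappa r : ℝ)) C →
          IsGibbsExpectedSH f C X θ
            (((-((p : ℝ) / 2) * (Real.log (2 * Real.pi) +
                (∫ r, Real.log (HyperVar.kappa r : ℝ) ∂C) + Real.log 2) : ℝ) : EReal) +
              ((1 / 2 : ℝ) : EReal) * objectiveSH f X)) := by
  have hpos : 0 < ∫ r, (HyperVar.kappa r : ℝ) ∂C :=
    integral_pos_of_ae_pos hκ_int (hκ_pos.mono fun _ => NNReal.coe_pos.2)
  rw [← hκσ]
  refine ⟨hpos, fun n X hF => ⟨fun r hr t => ?_, fun θ hθ => ?_⟩⟩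
  · rw [← targetValue_eq]
    exact ⟨fun hd => isTarget_weighted_iff hF hd hr t, isTarget_unweighted_iff hF t⟩
  · have hθ_eq (hd : 0 < pureErrorDF X) : ∀ᵐ r ∂C, θ r = targetValue f X r := by
      rcases hθ with hθ | hθ <;> filter_upwards [hθ, hκ_pos] with r ht hr
      · exact eq_targetValue_of_isTarget hp hF hd hr (Or.inl ht)
      · exact eq_targetValue_of_isTarget hp hF hd hr (Or.inr ht)
    exact ⟨isGibbsExpectedNSE hp hκ_pos hκ_int hF hθ_eq,
      fun hlog => isGibbsExpectedSH hp hκ_pos hlog hF hθ_eq⟩
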